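/- **Model.** Let $T\ge 2$, $0<\alpha\le 1$. For $t=0,\dots,T-1$ let $D_t$ be independent, almost surely non-negative, integrable random variables (demands) with distribution functions $F_t$; let $c_0,\dots,c_T\in\mathbb R$ (unit ordering costs, and salvage value $c_T$), $K_t\ge 0$ (setup costs) and $G_t:\mathbb R\to\mathbb R$ (expected holding and penalty cost of period $t$). In period $t$ the inventory level $x_t$ is observed and raised to $y_t=\pi_t(x_t)\ge x_t$ by a policy $\pi=(\pi_t)$ of Borel functions; then $x_{t+1}=y_t-D_t$. Let $v_0(x)$ be the minimum over all policies for which the total cost is integrable of $$E\Big[\sum_{t=0}^{T-1}\alpha^t\big(K_t\delta(y_t-x_t)+c_t(y_t-x_t)+G_t(y_t)\big)-\alpha^T c_T x_T\Big],\qquad x_0=x,$$ where $\delta(u)=1$ for $u>0$ and $\delta(0)=0$. Put $C_t(y)=(c_t-\alpha c_{t+1})y+G_t(y)+\alpha c_{t+1}E[D_t]$. Assume that each $C_t$ is convex with $C_t(y)\to\infty$ as $|y|\to\infty$, that $K_t\ge\alpha K_{t+1}$ for $t\le T-2$, and that $|C_t(x)-C_t(y)|\le\gamma_t|x-y|$ for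 all $x,y$, with constants $\gamma_t\ge0$. **Approximate policy.** Fix $\theta>0$; let $z_m=m\theta$ ($m\in\mathbb Z$), $Z_\theta=\{z_m\}$ and $f_t(n)=F_t(z_{n+1})-F_t(z_n)$. Let $C^m_t$ be the smallest minimizer of $C_t$, and let $S^U_t=\min\{z\in Z_\theta: z\ge C^m_t,\ C_t(z)>C_t(z_{n_0})+K_t\}$, where $z_{n_0}<C^m_t\le z_{n_0+1}$. In the last period let $s_{T-1}=\bar I_{T-1}$ be the point $y\le C^m_{T-1}$ with $C_{T-1}(y)=C_{T-1}(C^m_{T-1})+K_{T-1}$, and let $S_{T-1}=C^m_{T-1}$, $H_{T-1}=C_{T-1}$. For $t\le T-2$, recursively, $$I_t=\max\{z\in Z_\theta: z<\min(\bar I_{t+1}-\theta,\,C^m_t)\},\qquad \bar I_t=\max\{z\in Z_\theta: z\le I_t,\ C_t(z)>C_t(I_t)+K_t\}+\theta,$$ $$H_t(y)=C_t(y)+\alpha\sum_{n=-1}^\infty V_{t+1}(y-z_n)f_t(n),$$ $S_t$ is the largest minimizer of $H_t$ over $Z_\theta\cap[I_t,S^U_t]$; $s_t=S_t$ if $K_t=0$,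 and $s_t=\min\{z\in Z_\theta:\bar I_t\le z\le S_t,\ H_t(z)\le H_t(S_t)+K_t\}$ if $K_t>0$. For all $t\le T-1$, $V_t(y)=H_t(S_t)+K_t$ for $y<s_t$ and $V_t(y)=H_t(y)$ for $y\ge s_t$. **Error bounds.** Let $\psi_{T-1}(x,y)=\bar\psi_{T-1}(x,y)=\gamma_{T-1}x$, and let $\varphi_{T-1}(x,y)=\bar\varphi_{T-1}(x,y)$ be $0$ for $y<s_{T-1}$ and $\gamma_{T-1}x$ for $y\ge s_{T-1}$. For $t\le T-2$ let $\psi_t(x,y)=\gamma_t x$ if $y<s_{t+1}-\theta$, and otherwise $$\psi_t(x,y)=\gamma_t x+\alpha\sum_{m=-1}^{q}\varphi_{t+1}(x,y-z_m)f_t(m),\qquad z_q\le y-s_{t+1}<z_{q+1};$$ let $\varphi_t(x,y)$ be $0$ if $y<s_t$, $\psi_t(y-s_t,y)$ if $y\ge s_t>y-x$, and $\psi_t(x,y)$ if $y\ge s_t$ and $y-x\ge s_t$. Define $\bar\psi_t$ in the same way with $\bar\varphi_{t+1}$ in place of $\varphi_{t+1}$, and $\bar\varphi_t$ in the same way from $\bar\psi_t$,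 except that $\bar\varphi_t(x,y)=\bar\psi_t(y-s_t+\theta,y)$ if $y\ge s_t>y-x$. Let $\omega_{T-1}=\bar\omega_{T-1}=0$, and for $t\le T-2$ $$\omega_t(x)=\psi_t(\theta,x)-\gamma_t\theta+\alpha\sum_{n=-1}^\infty\bar\omega_{t+1}(x-z_n)f_t(n),\qquad \eta_t=\bar\psi_t(\theta,S^U_t)+\omega_t(S^U_t),$$ $\bar\omega_t(x)=\eta_t$ for $x\le S^U_t$ and $\bar\omega_t(x)=\max(\eta_t,\omega_t(x))$ for $x>S^U_t$. For $z\in Z_\theta$ let $\lambda_0(0)=z$, $\lambda_0(i)=\max(\lambda_0(i-1),S_{i-1})+\theta$, and $$\bar\epsilon_0(z)=\alpha^{T-1}\gamma_{T-1}\theta+\sum_{i=0}^{T-3}2\alpha^i\big[\bar\psi_i(\theta,\max(\lambda_0(i),S_i))-\gamma_i\theta\big]$$ (the sum is empty for $T=2$). **Theorem 4.7.** For every $k\in\mathbb Z$ and every $x$ with $z_{k-1}<x\le z_k$, the minimum defining $v_0(x)$ is attained, and $$-\bar\omega_0(z_k)\le v_0(x)-(V_0(x)-c_0x)\le\bar\epsilon_0(z_k).$$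 -/

import Mathlib

open MeasureTheory ProbabilityTheory Filter

noncomputable section

/-- The data of a finite-horizon inventory system: horizon `T`, discount factor `α`, unit ordering
costs `c 0, …, c (T-1)` and salvage value `c T`, setup costs `K t`, expected one-period holding and
penalty costs `G t y` (as functions of the level `y` after receipt of the order), and the demands
`D t`, random variables on a probability space `(Ω, P)`.  Values of the sequences at indices beyond
the horizon play no role. -/
structure InventorySystem (Ω : Type*) [MeasurableSpace Ω] where
  T : ℕ
  α : ℝ
  c : ℕ → ℝ
  K : ℕ → ℝ
  G : ℕ → ℝ → ℝ
  D : ℕ → Ω → ℝ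
  P : Measure Ω

namespace InventorySystem

variable {Ω : Type*} [MeasurableSpace Ω] (M : InventorySystem Ω) (θ : ℝ) (γ : ℕ → ℝ)

/-- `C_t(y) = (c_t - α c_{t+1}) y + G_t(y) + α c_{t+1} E[D_t]`. -/
def C (t : ℕ) (y : ℝ) : ℝ :=
  (M.c t - M.α * M.c (t + 1)) * y + M.G t y + M.α * M.c (t + 1) * ∫ ω, M.D t ω ∂M.P

/-- The standing assumptions on the model. -/
structure StandingAssumptions : Prop where
  isProb : IsProbabilityMeasure M.P
  α_pos : 0 < M.α
  α_le_one : M.α ≤ 1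
  D_measurable : ∀ t < M.T, Measurable (M.D t)
  D_nonneg : ∀ t < M.T, ∀ᵐ ω ∂M.P, 0 ≤ M.D t ω
  D_integrable : ∀ t < M.T, Integrable (M.D t) M.P
  D_indep : iIndepFun (fun t : Fin M.T => M.D t) M.P
  K_nonneg : ∀ t < M.T, 0 ≤ M.K t
  C_convex : ∀ t < M.T, ConvexOn ℝ Set.univ (M.C t)
  C_coercive : ∀ t < M.T, Tendsto (M.C t) (cocompact ℝ) atTop
  K_decr : ∀ t, t + 1 < M.T → M.α * M.K (t + 1) ≤ M.K t

/-- `γ_t ≥ 0` is a Lipschitz constant of `C_t`, for every period `t`. -/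
def LipschitzCondition : Prop :=
  ∀ t < M.T, 0 ≤ γ t ∧ ∀ x y, |M.C t x - M.C t y| ≤ γ t * |x - y|

/-! ### Policies and the optimal cost -/

/-- An ordering policy: in period `t`, on observing the inventory level `x`, the level is raised to
`pol t x ≥ x`. -/
def IsPolicy (pol : ℕ → ℝ → ℝ) : Prop :=
  ∀ t, Measurable (pol t) ∧ ∀ x, x ≤ pol t x

/-- The inventory level at the beginning of period `t + i` (before ordering), when the level at the
beginning of period `t` is `x` and the policy `pol` is used. Unsatisfied demand is backlogged. -/
def level (pol : ℕ → ℝ → ℝ) (t : ℕ) (x : ℝ) : ℕ → Ω → ℝ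
  | 0, _ => x
  | i + 1, ω => pol (t + i) (level pol t x i ω) - M.D (t + i) ω

/-- The cost of period `t` when the level is raised from `x` to `y`: setup cost (only if an order
is placed), ordering cost, expected holding and penalty cost. -/
def periodCost (t : ℕ) (x y : ℝ) : ℝ :=
  M.K t * (if 0 < y - x then 1 else 0) + M.c t * (y - x) + M.G t y

/-- The total discounted cost from period `t` to period `T`, including the terminal cost
`-c_T x_T`. -/
def totalCost (pol : ℕ → ℝ → ℝ) (t : ℕ) (x : ℝ) (ω : Ω) : ℝ :=
  (∑ i ∈ Finset.range (M.T - t), M.α ^ i *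
      M.periodCost (t + i) (M.level pol t x i ω) (pol (t + i) (M.level pol t x i ω)))
    + M.α ^ (M.T - t) * (-(M.c M.T) * M.level pol t x (M.T - t) ω)

/-- The finite total expected discounted costs that policies achieve from period `t` on, starting
with inventory level `x`. (Under the standing assumptions the total cost is bounded below by an
integrable random variable, so a policy that is left out here has expected cost `+∞`.) -/
def attainableCosts (t : ℕ) (x : ℝ) : Set ℝ :=
  {r | ∃ pol : ℕ → ℝ → ℝ, IsPolicy pol ∧ Integrable (M.totalCost pol t x) M.P ∧
    r = ∫ ω, M.totalCost pol t x ω ∂M.P}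

/-- The optimal cost `v_t(x)`. -/
def optimalCost (t : ℕ) (x : ℝ) : ℝ := sInf (M.attainableCosts t x)

/-! ### The grid and the discretized demand -/

/-- The grid `{m θ | m ∈ ℤ}`. -/
def grid : Set ℝ := {z | ∃ m : ℤ, z = m * θ}

/-- The cumulative distribution function of `D_t`. -/
def F (t : ℕ) (x : ℝ) : ℝ := M.P.real {ω | M.D t ω ≤ x}

/-- `f_t(n) = F_t((n+1)θ) - F_t(nθ)`. -/
def f (t : ℕ) (n : ℤ) : ℝ := M.F t ((n + 1) * θ) - M.F t (n * θ)

/-- `∑_{n=-1}^∞ g(y - nθ) f_t(n)`; the summation index is `n = i - 1`. -/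
def gridSum (t : ℕ) (g : ℝ → ℝ) (y : ℝ) : ℝ :=
  ∑' i : ℕ, g (y - ((i : ℝ) - 1) * θ) * M.f θ t ((i : ℤ) - 1)

/-! ### The approximate policy -/

/-- `C^m_t`, the smallest minimizer of `C_t`. -/
def Cm (t : ℕ) : ℝ := sInf {y | ∀ x, M.C t y ≤ M.C t x}

/-- `S^U_t`, the least grid point `z ≥ C^m_t` with `C_t(z) > C_t(n₀θ) + K_t`, where
`n₀θ < C^m_t ≤ (n₀+1)θ`. -/
def SU (t : ℕ) : ℝ :=
  sInf {z | z ∈ grid θ ∧ M.Cm t ≤ z ∧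
    M.C t (((⌈M.Cm t / θ⌉ - 1 : ℤ) : ℝ) * θ) + M.K t < M.C t z}

/-- The point `y ≤ C^m_t` with `C_t(y) = C_t(C^m_t) + K_t` (there is exactly one). -/
def Ybar (t : ℕ) : ℝ := sSup {y | y ≤ M.Cm t ∧ M.C t y = M.C t (M.Cm t) + M.K t}

/- The quantities below are defined by backward recursion on the period. They carry two indices:
the period `t` and the number `n` of periods after it, so that `n = T - 1 - t`; the case `n = 0` is
the last period `t = T - 1`, and `(n + 1, t)` is computed from `(n, t + 1)`. -/

/-- The largest grid point `< min (b - θ) C^m_t`; this is `I_t` when `b` is `Ī_{t+1}`. -/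
def lowerPoint (t : ℕ) (b : ℝ) : ℝ := sSup {z | z ∈ grid θ ∧ z < min (b - θ) (M.Cm t)}

/-- `Ī_t`. -/
def Ibar : ℕ → ℕ → ℝ
  | 0, t => M.Ybar t
  | n + 1, t =>
    sSup {z | z ∈ grid θ ∧ z ≤ M.lowerPoint θ t (Ibar n (t + 1)) ∧
      M.C t (M.lowerPoint θ t (Ibar n (t + 1))) + M.K t < M.C t z} + θ

/-- `S_t`, given the function `h = H_t`: in the last period it is `C^m_t`; before, it is the largest
minimizer of `h` among the grid points in `[I_t, S^U_t]`. -/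
def orderUpTo : ℕ → ℕ → (ℝ → ℝ) → ℝ
  | 0, t, _ => M.Cm t
  | n + 1, t, h =>
    let I := M.lowerPoint θ t (M.Ibar θ n (t + 1))
    sSup {z | z ∈ grid θ ∧ I ≤ z ∧ z ≤ M.SU θ t ∧
      ∀ w ∈ grid θ, I ≤ w → w ≤ M.SU θ t → h z ≤ h w}

open Classical in
/-- `s_t`, given the function `h = H_t`. -/
def reorder : ℕ → ℕ → (ℝ → ℝ) → ℝ
  | 0, t, _ => M.Ybar t
  | n + 1, t, h =>
    let S := M.orderUpTo θ (n + 1) t h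
    if M.K t = 0 then S
    else sInf {z | z ∈ grid θ ∧ M.Ibar θ (n + 1) t ≤ z ∧ z ≤ S ∧ h z ≤ h S + M.K t}

/-- `V_t`, given the function `h = H_t`. -/
def Vof (n t : ℕ) (h : ℝ → ℝ) (y : ℝ) : ℝ :=
  if y < M.reorder θ n t h then h (M.orderUpTo θ n t h) + M.K t else h y

/-- `H_t`. -/
def Hrec : ℕ → ℕ → ℝ → ℝ
  | 0, t => M.C t
  | n + 1, t => fun y =>
    M.C t y + M.α * M.gridSum θ t (M.Vof θ n (t + 1) (Hrec n (t + 1))) y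

/-- `S_t`. -/
def Srec (n t : ℕ) : ℝ := M.orderUpTo θ n t (M.Hrec θ n t)

/-- `s_t`. -/
def srec (n t : ℕ) : ℝ := M.reorder θ n t (M.Hrec θ n t)

/-- The computable function `V_t`, for `t = 0, …, T - 1`. -/
def V (t : ℕ) (y : ℝ) : ℝ := M.Vof θ (M.T - 1 - t) t (M.Hrec θ (M.T - 1 - t) t) y

/-! ### The error bounds -/

/-- `φ_t` given `p = ψ_t`. -/
def phiOf : ℕ → ℕ → (ℝ → ℝ → ℝ) → ℝ → ℝ → ℝ
  | 0, t, p => fun x y => if y < M.srec θ 0 t then 0 else p x y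
  | n + 1, t, p => fun x y =>
    if y < M.srec θ (n + 1) t then 0
    else if y - x < M.srec θ (n + 1) t then p (y - M.srec θ (n + 1) t) y
    else p x y

/-- `ψ_t`. The upper summation index is the integer `q` with
`qθ ≤ y - s_{t+1} < (q + 1)θ`. -/
def psi : ℕ → ℕ → ℝ → ℝ → ℝ
  | 0, t => fun x _ => γ t * x
  | n + 1, t => fun x y =>
    if y < M.srec θ n (t + 1) - θ then γ t * x
    else γ t * x + M.α * ∑ m ∈ Finset.Icc (-1 : ℤ) ⌊(y - M.srec θ n (t + 1)) / θ⌋,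
      M.phiOf θ n (t + 1) (psi n (t + 1)) x (y - m * θ) * M.f θ t m

/-- `φ̄_t` given `p = ψ̄_t`. -/
def phiBarOf : ℕ → ℕ → (ℝ → ℝ → ℝ) → ℝ → ℝ → ℝ
  | 0, t, p => fun x y => if y < M.srec θ 0 t then 0 else p x y
  | n + 1, t, p => fun x y =>
    if y < M.srec θ (n + 1) t then 0
    else if y - x < M.srec θ (n + 1) t then p (y - M.srec θ (n + 1) t + θ) y
    else p x y

/-- `ψ̄_t`. -/
def psiBar : ℕ → ℕ → ℝ → ℝ → ℝ
  | 0, t => fun x _ => γ t * x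
  | n + 1, t => fun x y =>
    if y < M.srec θ n (t + 1) - θ then γ t * x
    else γ t * x + M.α * ∑ m ∈ Finset.Icc (-1 : ℤ) ⌊(y - M.srec θ n (t + 1)) / θ⌋,
      M.phiBarOf θ n (t + 1) (psiBar n (t + 1)) x (y - m * θ) * M.f θ t m

/-- `ω̄_t` given `w = ω_t`; here `η_t = ψ̄_t(θ, S^U_t) + ω_t(S^U_t)`. -/
def omegaBarOf : ℕ → ℕ → (ℝ → ℝ) → ℝ → ℝ
  | 0, _, _ => fun _ => 0
  | n + 1, t, w => fun x =>
    let η := M.psiBar θ γ (n + 1) t θ (M.SU θ t) + w (M.SU θ t)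
    if x ≤ M.SU θ t then η else max η (w x)

/-- `ω_t`. -/
def omegaRec : ℕ → ℕ → ℝ → ℝ
  | 0, _ => fun _ => 0
  | n + 1, t => fun x =>
    M.psi θ γ (n + 1) t θ x - γ t * θ
      + M.α * M.gridSum θ t (M.omegaBarOf θ γ n (t + 1) (omegaRec n (t + 1))) x

/-- `ω̄_t`, for `t = 0, …, T - 1`. -/
def omegaBar (t : ℕ) (x : ℝ) : ℝ :=
  M.omegaBarOf θ γ (M.T - 1 - t) t (M.omegaRec θ γ (M.T - 1 - t) t) x

/-- `λ_t(i)`, with `λ_t(0) = z`. -/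
def lam (t : ℕ) (z : ℝ) : ℕ → ℝ
  | 0 => z
  | i + 1 => max (lam t z i) (M.Srec θ (M.T - 1 - (t + i)) (t + i)) + θ

/-- `ε̄_t(z)`, for `t = 0, …, T - 2`. The sum runs over `0 ≤ i ≤ T - 3 - t`; it is empty for
`t = T - 2`. -/
def epsBar (t : ℕ) (z : ℝ) : ℝ :=
  M.α ^ (M.T - 1 - t) * γ (M.T - 1) * θ
    + ∑ i ∈ Finset.range (M.T - 2 - t), 2 * M.α ^ i *
      (M.psiBar θ γ (M.T - 1 - (t + i)) (t + i) θ
          (max (M.lam θ t z i) (M.Srec θ (M.T - 1 - (t + i)) (t + i)))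
        - γ (t + i) * θ)

end InventorySystem

end

namespace InventorySystem

/-! ### Grid points -/

section Grid

variable {θ : ℝ}

/-! Let R be the demand D rounded strictly down to the grid, so that R < D ≤ R + θ almost surely.
The series in H_t is the expectation E[V_{t+1}(y - R)]. The approximation is thus a dynamic program
driven by R with orders to grid points, and the proof compares it with the exact one.

Exact side: put u_t(x) = v_t(x) + c_t x and J_t(y) = C_t(y) + α E[u_{t+1}(y - D)]. The linear
ordering costs telescope into the C_t plus a term of mean zero, so u_t(x) is the smaller of J_t(x)
and K_t + inf of J_t over [x, ∞). Coercivity yields measurable minimizers, hence an optimal policy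
(`isLeast_attainableCosts`).

Structure of the approximation: R takes values in the grid, so Scarf's K-convexity argument works on
triples of grid points, with α K_{t+1} ≤ K_t carrying it from one period to the preceding one. It
shows that (s_t, S_t) is optimal on the grid and that the finite search windows lose nothing
(`isOptimalOnGrid`). Off the grid, optimality holds only up to the oscillation of H_t within a cell.

Two moduli control V_t. A rise of the level by at most x increases V_t by at most φ_t(x, ·)
(`Vrec_sub_le_phi`); the variation within the grid cell ending in z is at most φ̄_t(θ, z)
(`cellVariationLE_Vrec`).

Both bounds follow by backward induction. For V ≤ u + ω̄ (`Vrec_le_optValue_add`), replacing D by R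
raises the level by at most θ, which gives H ≤ J + ω; passing to the minimum costs one further cell
variation at S^U, whence η. For u ≤ V + ε̄ (`optValue_le_Vrec_add`), the (s, S) rule is tried in the
exact problem; y - D and y - R lie in the same or in adjacent cells, hence the factor 2. -/

theorem grid_add_int_mul {z : ℝ} (hz : z ∈ grid θ) (n : ℤ) : z + n * θ ∈ grid θ := by
  obtain ⟨m, rfl⟩ := hz
  exact ⟨m + n, by push_cast; ring⟩

theorem grid_sub_int_mul {z : ℝ} (hz : z ∈ grid θ) (n : ℤ) : z - n * θ ∈ grid θ := by
  obtain ⟨m, rfl⟩ := hz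
  exact ⟨m - n, by push_cast; ring⟩

theorem grid_add {z : ℝ} (hz : z ∈ grid θ) : z + θ ∈ grid θ := by
  simpa using grid_add_int_mul hz 1

theorem grid_sub {z : ℝ} (hz : z ∈ grid θ) : z - θ ∈ grid θ := by
  simpa using grid_sub_int_mul hz 1

theorem grid_max {z w : ℝ} (hz : z ∈ grid θ) (hw : w ∈ grid θ) : max z w ∈ grid θ := by
  rcases max_choice z w with h | h <;> rwa [h]

theorem grid_le_sub {z w : ℝ} (hθ : 0 < θ) (hz : z ∈ grid θ) (hw : w ∈ grid θ) (h : z < w) :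
    z ≤ w - θ := by
  obtain ⟨m, rfl⟩ := hz
  obtain ⟨n, rfl⟩ := hw
  have h1 : (m : ℝ) < n := lt_of_mul_lt_mul_right h hθ.le
  have h2 : m + 1 ≤ n := by exact_mod_cast h1
  have h3 : (m : ℝ) + 1 ≤ n := by exact_mod_cast h2
  nlinarith

theorem exists_grid_cell (hθ : 0 < θ) (x : ℝ) : ∃ z ∈ grid θ, z - θ < x ∧ x ≤ z := by
  refine ⟨⌈x / θ⌉ * θ, ⟨_, rfl⟩, ?_, ?_⟩
  · have := Int.ceil_lt_add_one (x / θ)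
    have h : (⌈x / θ⌉ - 1 : ℝ) * θ < x := by
      rw [← lt_div_iff₀ hθ]; linarith
    linarith
  · rw [← div_le_iff₀ hθ]; exact Int.le_ceil _

theorem sSup_mem_of_subset_grid (hθ : 0 < θ) {A : Set ℝ} (hA : A ⊆ grid θ) (hne : A.Nonempty)
    (hb : BddAbove A) : sSup A ∈ A := by
  obtain ⟨b, hb⟩ := hb
  obtain ⟨z, hz⟩ := hne
  obtain ⟨m, rfl⟩ := hA hz
  obtain ⟨u, hu, hmax⟩ := Int.exists_greatest_of_bdd (P := fun n : ℤ => (n : ℝ) * θ ∈ A)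
    ⟨⌊b / θ⌋, fun n hn => Int.le_floor.2 ((le_div_iff₀ hθ).2 (hb hn))⟩ ⟨m, hz⟩
  have : IsGreatest A (u * θ) := by
    refine ⟨hu, fun w hw => ?_⟩
    obtain ⟨n, rfl⟩ := hA hw
    exact mul_le_mul_of_nonneg_right (by exact_mod_cast hmax n hw) hθ.le
  rw [this.csSup_eq]; exact hu

theorem sInf_mem_of_subset_grid (hθ : 0 < θ) {A : Set ℝ} (hA : A ⊆ grid θ) (hne : A.Nonempty)
    (hb : BddBelow A) : sInf A ∈ A := by
  obtain ⟨b, hb⟩ := hb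
  obtain ⟨z, hz⟩ := hne
  obtain ⟨m, rfl⟩ := hA hz
  obtain ⟨u, hu, hmin⟩ := Int.exists_least_of_bdd (P := fun n : ℤ => (n : ℝ) * θ ∈ A)
    ⟨⌈b / θ⌉, fun n hn => Int.ceil_le.2 ((div_le_iff₀ hθ).2 (hb hn))⟩ ⟨m, hz⟩
  have : IsLeast A (u * θ) := by
    refine ⟨hu, fun w hw => ?_⟩
    obtain ⟨n, rfl⟩ := hA hw
    exact mul_le_mul_of_nonneg_right (by exact_mod_cast hmin n hw) hθ.le
  rw [this.csInf_eq]; exact hu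

/-- A function attains its minimum over the grid points of a compact interval. -/
theorem exists_grid_min (hθ : 0 < θ) (h : ℝ → ℝ) {a b : ℝ} (ha : a ∈ grid θ) (hab : a ≤ b) :
    ∃ z ∈ grid θ, a ≤ z ∧ z ≤ b ∧ ∀ w ∈ grid θ, a ≤ w → w ≤ b → h z ≤ h w := by
  obtain ⟨m, rfl⟩ := ha
  have hne : (Finset.Icc m ⌊b / θ⌋).Nonempty :=
    ⟨m, Finset.mem_Icc.2 ⟨le_rfl, Int.le_floor.2 ((le_div_iff₀ hθ).2 hab)⟩⟩
  obtain ⟨n, hn, hmin⟩ := Finset.exists_min_image _ (fun i : ℤ => h (i * θ)) hne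
  have key : ∀ i : ℤ, (m : ℝ) * θ ≤ i * θ → (i : ℝ) * θ ≤ b → i ∈ Finset.Icc m ⌊b / θ⌋ := by
    intro i h1 h2
    refine Finset.mem_Icc.2 ⟨?_, Int.le_floor.2 ((le_div_iff₀ hθ).2 h2)⟩
    exact_mod_cast le_of_mul_le_mul_right h1 hθ
  rw [Finset.mem_Icc] at hn
  refine ⟨n * θ, ⟨n, rfl⟩, ?_, ?_, ?_⟩
  · exact mul_le_mul_of_nonneg_right (by exact_mod_cast hn.1) hθ.le
  · exact (le_div_iff₀ hθ).1 (Int.le_floor.1 hn.2)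
  · rintro _ ⟨i, rfl⟩ h1 h2
    exact hmin i (key i h1 h2)

end Grid

/-! ### Convex coercive functions on the line -/

section Convex

variable {f : ℝ → ℝ}

theorem le_of_convex_of_le_argmin (hf : ConvexOn ℝ Set.univ f) {m x y : ℝ} (hm : ∀ w, f m ≤ f w)
    (hxy : x ≤ y) (hym : y ≤ m) : f y ≤ f x := by
  have := hf.le_max_of_mem_Icc (Set.mem_univ x) (Set.mem_univ m) ⟨hxy, hym⟩
  rwa [max_eq_left (hm x)] at this

theorem le_of_convex_of_argmin_le (hf : ConvexOn ℝ Set.univ f) {m x y : ℝ} (hm : ∀ w, f m ≤ f w)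
    (hmx : m ≤ x) (hxy : x ≤ y) : f x ≤ f y := by
  have := hf.le_max_of_mem_Icc (Set.mem_univ m) (Set.mem_univ y) ⟨hmx, hxy⟩
  rwa [max_eq_right (hm y)] at this

theorem tendsto_atTop_of_coercive (hf : Tendsto f (cocompact ℝ) atTop) : Tendsto f atTop atTop :=
  hf.mono_left atTop_le_cocompact

theorem tendsto_atBot_of_coercive (hf : Tendsto f (cocompact ℝ) atTop) : Tendsto f atBot atTop :=
  hf.mono_left atBot_le_cocompact

theorem exists_argmin (hc : Continuous f) (hf : Tendsto f (cocompact ℝ) atTop) :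
    ∃ m, ∀ x, f m ≤ f x :=
  hc.exists_forall_le hf

/-- A convex coercive function grows at least linearly. -/
theorem exists_linear_growth (hc : Continuous f) (hf : ConvexOn ℝ Set.univ f)
    (hco : Tendsto f (cocompact ℝ) atTop) : ∃ ε > 0, ∃ B, ∀ y, ε * |y| - B ≤ f y := by
  obtain ⟨m, hm⟩ := exists_argmin hc hco
  obtain ⟨R₁, hR₁⟩ := ((tendsto_atTop_of_coercive hco).eventually_ge_atTop (f 0 + 1)).and
    (eventually_ge_atTop (1 : ℝ)) |>.exists
  obtain ⟨R₂, hR₂⟩ := ((tendsto_atBot_of_coercive hco).eventually_ge_atTop (f 0 + 1)).and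
    (eventually_le_atBot (-1 : ℝ)) |>.exists
  -- Convexity along the ray from 0 through r: a rise of 1 at r forces a rise of at least k at k r.
  have key : ∀ r : ℝ, r ≠ 0 → f 0 + 1 ≤ f r → ∀ k : ℝ, 1 ≤ k → f 0 + k ≤ f (k * r) := by
    intro r _ hr k hk
    have hk0 : 0 < k := by linarith
    have := hf.2 (Set.mem_univ (k * r)) (Set.mem_univ 0)
      (show (0 : ℝ) ≤ 1 / k by positivity)
      (show (0 : ℝ) ≤ 1 - 1 / k by rw [sub_nonneg, div_le_one hk0]; exact hk) (by ring)
    simp only [smul_eq_mul, mul_zero, add_zero] at this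
    rw [show 1 / k * (k * r) = r by field_simp] at this
    have h2 : 1 ≤ 1 / k * (f (k * r) - f 0) := by linarith
    rw [one_div, inv_mul_eq_div, le_div_iff₀ hk0] at h2
    linarith
  set R := max R₁ (-R₂) with hR
  have hR0 : 0 < R := lt_of_lt_of_le (by linarith [hR₁.2]) (le_max_left _ _)
  -- The slope 1 / R serves both rays. On the middle interval |y| / R ≤ 1, and the constant reduces
  -- the claim to f y ≥ f m.
  refine ⟨1 / R, by positivity, 1 - f m + |f 0|, fun y => ?_⟩
  have hfm := hm 0
  have h1R : ∀ a b : ℝ, 0 ≤ a → 0 < b → b ≤ R → 1 / R * a ≤ a / b := by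
    intro a b ha hb hbR
    rw [one_div, inv_mul_eq_div]
    gcongr
  have habs := neg_abs_le (f 0)
  by_cases h1 : R₁ ≤ y
  · have hy : 0 < R₁ := by linarith [hR₁.2]
    have := key R₁ hy.ne' hR₁.1 (y / R₁) (by rwa [le_div_iff₀ hy, one_mul])
    rw [div_mul_cancel₀ _ hy.ne'] at this
    rw [abs_of_nonneg (by linarith)]
    have := h1R y R₁ (by linarith) hy (le_max_left _ _)
    have := le_abs_self (f 0)
    linarith [hm 0]
  by_cases h2 : y ≤ R₂
  · have hy : 0 < -R₂ := by linarith [hR₂.2]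
    have := key R₂ (by linarith) hR₂.1 (y / R₂) (by
      rw [← neg_div_neg_eq, le_div_iff₀ hy]; linarith)
    rw [div_mul_cancel₀ _ (by linarith)] at this
    rw [abs_of_nonpos (by linarith)]
    have := h1R (-y) (-R₂) (by linarith) hy (le_max_right _ _)
    rw [neg_div_neg_eq] at this
    have := le_abs_self (f 0)
    linarith [hm 0]
  · have hy : |y| ≤ R := by
      rw [abs_le]
      have := le_max_left R₁ (-R₂)
      have := le_max_right R₁ (-R₂)
      constructor <;> linarith
    have : 1 / R * |y| ≤ 1 := by
      rw [one_div, inv_mul_eq_div, div_le_one hR0]; exact hy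
    linarith [hm y, abs_nonneg (f 0)]

end Convex

/-! ### `K`-convexity -/

/-- `K`-convexity of `f` along the points of `E`. -/
def KConvexOn (E : Set ℝ) (K : ℝ) (f : ℝ → ℝ) : Prop :=
  ∀ a ∈ E, ∀ b ∈ E, ∀ c ∈ E, a ≤ b → b ≤ c →
    (c - a) * f b ≤ (c - b) * f a + (b - a) * (K + f c)

theorem _root_.ConvexOn.kConvexOn {f : ℝ → ℝ} (hf : ConvexOn ℝ Set.univ f) (E : Set ℝ) {K : ℝ}
    (hK : 0 ≤ K) : KConvexOn E K f := by
  intro a _ b _ c _ hab hbc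
  rcases (hab.trans hbc).eq_or_lt with h | h
  · obtain rfl : a = b := by linarith
    obtain rfl : a = c := h
    simp
  · have h0 : 0 < c - a := by linarith
    have := hf.2 (Set.mem_univ a) (Set.mem_univ c)
      (show 0 ≤ (c - b) / (c - a) from div_nonneg (by linarith) h0.le)
      (show 0 ≤ (b - a) / (c - a) from div_nonneg (by linarith) h0.le)
      (by field_simp; ring)
    simp only [smul_eq_mul] at this
    rw [show (c - b) / (c - a) * a + (b - a) / (c - a) * c = b by field_simp; ring] at this
    have h2 := mul_le_mul_of_nonneg_left this h0.le
    have h3 : (c - a) * ((c - b) / (c - a) * f a + (b - a) / (c - a) * f c)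
        = (c - b) * f a + (b - a) * f c := by field_simp
    nlinarith [mul_nonneg (sub_nonneg.2 hab) hK]

/-- The value function of an `(s, S)` policy with cost-to-go `h`. -/
noncomputable def thresholdValue (K S s : ℝ) (h : ℝ → ℝ) (y : ℝ) : ℝ := if y < s then h S + K else h y

/-- The `(s, S)` policy is optimal for `h` along `E`, except possibly below `s`. -/
structure IsThreshold (E : Set ℝ) (K S s : ℝ) (h : ℝ → ℝ) : Prop where
  K_nonneg : 0 ≤ K
  mem : S ∈ E
  le : s ≤ S
  isMin : ∀ w ∈ E, h S ≤ h w
  between : ∀ b ∈ E, s ≤ b → b ≤ S → h b ≤ K + h S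
  kConvex : KConvexOn E K h

namespace IsThreshold

variable {E : Set ℝ} {K S s : ℝ} {h : ℝ → ℝ}

/-- Up to S, `h a` is within K of the minimum. Beyond S, K-convexity on S, a, b combined with h S ≤
h a leaves h a ≤ K + h b. -/
theorem le_add (H : IsThreshold E K S s h) {a b : ℝ} (ha : a ∈ E) (hb : b ∈ E) (hsa : s ≤ a)
    (hab : a ≤ b) : h a ≤ K + h b := by
  rcases le_or_gt a S with h1 | h1
  · linarith [H.between a ha hsa h1, H.isMin b hb]
  · have := H.kConvex S H.mem a ha b hb h1.le hab
    have h2 := H.isMin a ha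
    have h3 : (a - S) * h a ≤ (a - S) * (K + h b) := by nlinarith
    exact le_of_mul_le_mul_left h3 (by linarith)

theorem value_ge (H : IsThreshold E K S s h) {b : ℝ} (hb : b ∈ E) :
    h S ≤ thresholdValue K S s h b := by
  unfold thresholdValue
  split_ifs
  · linarith [H.K_nonneg]
  · exact H.isMin b hb

theorem value_le_add (H : IsThreshold E K S s h) {a b : ℝ} (ha : a ∈ E) (hb : b ∈ E)
    (hab : a ≤ b) : thresholdValue K S s h a ≤ K + thresholdValue K S s h b := by
  have h1 := H.value_ge hb
  rcases lt_or_ge a s with h2 | h2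
  · rw [thresholdValue, if_pos h2]; linarith
  · rw [thresholdValue, if_neg h2.not_gt, thresholdValue, if_neg (h2.trans hab).not_gt]
    exact H.le_add ha hb h2 hab

/-- Scarf's argument, by the position of s among the three points. The only delicate case has a < s
≤ b with h b above K + h S: then b lies beyond S and K-convexity of h on S, b, c applies. -/
theorem value_kConvex (H : IsThreshold E K S s h) : KConvexOn E K (thresholdValue K S s h) := by
  intro a ha b hb c hc hab hbc
  have hK := H.K_nonneg
  unfold thresholdValue
  rcases lt_or_ge a s with h1 | h1
  swap
  · rw [if_neg h1.not_gt, if_neg (h1.trans hab).not_gt, if_neg (h1.trans (hab.trans hbc)).not_gt]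
    exact H.kConvex a ha b hb c hc hab hbc
  rw [if_pos h1]
  rcases lt_or_ge b s with h2 | h2
  · rw [if_pos h2]
    rcases lt_or_ge c s with h3 | h3
    · rw [if_pos h3]; nlinarith
    · rw [if_neg h3.not_gt]; nlinarith [H.isMin c hc]
  rw [if_neg h2.not_gt, if_neg (h2.trans hbc).not_gt]
  have hc' := H.isMin c hc
  rcases le_or_gt (h b) (K + h S) with h3 | h3
  · nlinarith
  · have hSb : S < b := by
      by_contra hcon
      exact absurd (H.between b hb h2 (not_lt.1 hcon)) (not_le.2 h3)
    have h4 := H.kConvex S H.mem b hb c hc hSb.le hbc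
    have h5 := H.le_add hb hc h2 hbc
    -- Moving the left point from S out to a helps, since h b - K - h c ≤ 0 and a < s ≤ S.
    have h6 : (b - a) * (h b - K - h c) ≤ (b - S) * (h b - K - h c) :=
      mul_le_mul_of_nonpos_right (by linarith [H.le]) (by linarith)
    nlinarith

end IsThreshold

end InventorySystem

namespace InventorySystem

/-! ### The rounded demand -/

/-- A function that is constant near `-∞`. -/
def LeftConst (g : ℝ → ℝ) : Prop := ∃ s c, ∀ y < s, g y = c

theorem leftConst_thresholdValue (K S s : ℝ) (h : ℝ → ℝ) : LeftConst (thresholdValue K S s h) :=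
  ⟨s, h S + K, fun _ hy => if_pos hy⟩

variable {Ω : Type*} [MeasurableSpace Ω] (M : InventorySystem Ω) (θ : ℝ)

/-- The demand of period `t`, rounded down to the grid (strictly). -/
noncomputable def roundedDemand (t : ℕ) (ω : Ω) : ℝ := ((⌈M.D t ω / θ⌉₊ : ℝ) - 1) * θ

theorem grid_sub_roundedDemand {z : ℝ} (hz : z ∈ grid θ) (t : ℕ) (ω : Ω) :
    z - M.roundedDemand θ t ω ∈ grid θ := by
  have := grid_sub_int_mul hz ((⌈M.D t ω / θ⌉₊ : ℤ) - 1)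
  rwa [roundedDemand, show ((⌈M.D t ω / θ⌉₊ : ℝ) - 1) = (((⌈M.D t ω / θ⌉₊ : ℤ) - 1 : ℤ) : ℝ) by
    push_cast; rfl]

variable {M θ}

theorem neg_le_roundedDemand (hθ : 0 < θ) (t : ℕ) (ω : Ω) : -θ ≤ M.roundedDemand θ t ω := by
  have : (0 : ℝ) ≤ (⌈M.D t ω / θ⌉₊ : ℝ) := Nat.cast_nonneg _
  unfold roundedDemand
  nlinarith

theorem roundedDemand_lt (hθ : 0 < θ) {t : ℕ} {ω : Ω} (h0 : 0 ≤ M.D t ω) :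
    M.roundedDemand θ t ω < M.D t ω := by
  unfold roundedDemand
  have := Nat.ceil_lt_add_one (div_nonneg h0 hθ.le)
  rw [← lt_div_iff₀ hθ]
  linarith

theorem le_roundedDemand_add (hθ : 0 < θ) (t : ℕ) (ω : Ω) :
    M.D t ω ≤ M.roundedDemand θ t ω + θ := by
  unfold roundedDemand
  have := Nat.le_ceil (M.D t ω / θ)
  rw [div_le_iff₀ hθ] at this
  linarith

theorem f_eq_measureReal (hM : M.StandingAssumptions) (hθ : 0 < θ) {t : ℕ} (ht : t < M.T)
    (i : ℕ) : M.f θ t ((i : ℤ) - 1) = M.P.real {ω | ⌈M.D t ω / θ⌉₊ = i} := by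
  have := hM.isProb
  have hm := hM.D_measurable t ht
  unfold f F
  push_cast
  have hset : ∀ r : ℝ, MeasurableSet {ω | M.D t ω ≤ r} := fun r => measurableSet_le hm measurable_const
  have hsub : {ω | M.D t ω ≤ ((i : ℝ) - 1) * θ} ⊆ {ω | M.D t ω ≤ ((i : ℝ) - 1 + 1) * θ} :=
    fun ω hω => by
      simp only [Set.mem_ofPred_eq] at hω ⊢
      nlinarith
  rw [← measureReal_sdiff hsub (hset _)]
  refine measureReal_congr ?_
  filter_upwards [hM.D_nonneg t ht] with ω hω
  apply propext
  change (M.D t ω ≤ ((i : ℝ) - 1 + 1) * θ ∧ ¬ M.D t ω ≤ ((i : ℝ) - 1) * θ) ↔ ⌈M.D t ω / θ⌉₊ = i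
  rw [← div_le_iff₀ hθ, ← div_le_iff₀ hθ, not_le, sub_add_cancel]
  have h0 : 0 ≤ M.D t ω / θ := div_nonneg hω hθ.le
  -- The index i = 0 is the grid interval n = -1; for non-negative demand its mass is that of D = 0,
  -- which is rounded to -θ.
  rcases Nat.eq_zero_or_pos i with rfl | hi
  · rw [Nat.ceil_eq_zero]
    refine ⟨fun h => by simpa using h.1, fun h => ⟨by simpa using h, ?_⟩⟩
    push_cast
    linarith
  · rw [Nat.ceil_eq_iff hi.ne', Nat.cast_pred hi]
    tauto

theorem measurable_ceil_demand (hM : M.StandingAssumptions) {t : ℕ} (ht : t < M.T) :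
    Measurable fun ω => ⌈M.D t ω / θ⌉₊ :=
  Nat.measurable_ceil.comp ((hM.D_measurable t ht).div_const θ)

/-- Only finitely many of the sample points lie to the right of the threshold below which g is
constant. -/
theorem LeftConst.exists_bound {g : ℝ → ℝ} (hg : LeftConst g) (hθ : 0 < θ) (y : ℝ) :
    ∃ B, ∀ i : ℕ, |g (y - ((i : ℝ) - 1) * θ)| ≤ B := by
  obtain ⟨s, c, hs⟩ := hg
  obtain ⟨n, hn⟩ := exists_nat_gt ((y - s) / θ + 1)
  refine ⟨|c| + ∑ i ∈ Finset.range n, |g (y - ((i : ℝ) - 1) * θ)|, fun i => ?_⟩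
  by_cases hi : i < n
  · have := Finset.single_le_sum (f := fun i : ℕ => |g (y - ((i : ℝ) - 1) * θ)|)
      (fun i _ => abs_nonneg _) (Finset.mem_range.2 hi)
    linarith [abs_nonneg c]
  · have h1 : (n : ℝ) ≤ i := by exact_mod_cast not_lt.1 hi
    have h2 : (y - s) / θ < (i : ℝ) - 1 := by linarith
    rw [div_lt_iff₀ hθ] at h2
    rw [hs _ (by linarith)]
    have := Finset.sum_nonneg (s := Finset.range n)
      (fun i _ => abs_nonneg (g (y - ((i : ℝ) - 1) * θ)))
    linarith

/-- No measurability of g is needed, because the rounded demand factors through a measurable map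
into ℕ. -/
theorem LeftConst.integrable {g : ℝ → ℝ} (hg : LeftConst g) (hM : M.StandingAssumptions)
    (hθ : 0 < θ) {t : ℕ} (ht : t < M.T) (y : ℝ) :
    Integrable (fun ω => g (y - M.roundedDemand θ t ω)) M.P := by
  have := hM.isProb
  obtain ⟨B, hB⟩ := hg.exists_bound hθ y
  refine Integrable.of_bound (C := B) ?_ (Eventually.of_forall fun ω => hB _)
  exact ((measurable_from_top (f := fun i : ℕ => g (y - ((i : ℝ) - 1) * θ))).comp
    (measurable_ceil_demand hM ht)).aestronglyMeasurable

theorem LeftConst.gridSum_eq {g : ℝ → ℝ} (hg : LeftConst g) (hM : M.StandingAssumptions)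
    (hθ : 0 < θ) {t : ℕ} (ht : t < M.T) (y : ℝ) :
    M.gridSum θ t g y = ∫ ω, g (y - M.roundedDemand θ t ω) ∂M.P := by
  have := hM.isProb
  have hN := measurable_ceil_demand (θ := θ) hM ht
  have hint := hg.integrable hM hθ ht y
  have hmeas : AEStronglyMeasurable (fun i : ℕ => g (y - ((i : ℝ) - 1) * θ))
      (M.P.map fun ω => ⌈M.D t ω / θ⌉₊) := measurable_from_top.aestronglyMeasurable
  have h1 : ∫ ω, g (y - M.roundedDemand θ t ω) ∂M.P
      = ∫ i : ℕ, g (y - ((i : ℝ) - 1) * θ) ∂(M.P.map fun ω => ⌈M.D t ω / θ⌉₊) :=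
    (integral_map hN.aemeasurable hmeas).symm
  have h2 : Integrable (fun i : ℕ => g (y - ((i : ℝ) - 1) * θ))
      (M.P.map fun ω => ⌈M.D t ω / θ⌉₊) := (integrable_map_measure hmeas hN.aemeasurable).2 hint
  rw [h1, integral_countable h2, gridSum]
  refine tsum_congr fun i => ?_
  rw [f_eq_measureReal hM hθ ht, map_measureReal_apply hN (MeasurableSet.singleton i), smul_eq_mul,
    mul_comm]
  rfl

theorem gridSum_mono {g₁ g₂ : ℝ → ℝ} (h₁ : LeftConst g₁) (h₂ : LeftConst g₂)
    (hM : M.StandingAssumptions) (hθ : 0 < θ) {t : ℕ} (ht : t < M.T) {y₁ y₂ : ℝ}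
    (h : ∀ ω, g₁ (y₁ - M.roundedDemand θ t ω) ≤ g₂ (y₂ - M.roundedDemand θ t ω)) :
    M.gridSum θ t g₁ y₁ ≤ M.gridSum θ t g₂ y₂ := by
  rw [h₁.gridSum_eq hM hθ ht, h₂.gridSum_eq hM hθ ht]
  exact integral_mono (h₁.integrable hM hθ ht _) (h₂.integrable hM hθ ht _) h

theorem gridSum_nonneg {g : ℝ → ℝ} (hg : LeftConst g) (hM : M.StandingAssumptions) (hθ : 0 < θ)
    {t : ℕ} (ht : t < M.T) {y : ℝ} (h : ∀ ω, 0 ≤ g (y - M.roundedDemand θ t ω)) :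
    0 ≤ M.gridSum θ t g y := by
  rw [hg.gridSum_eq hM hθ ht]
  exact integral_nonneg h

/-- If `g` is constant below `s`, then so is its grid sum, up to the shift by `θ`. -/
theorem gridSum_of_lt {g : ℝ → ℝ} {s c : ℝ} (hg : ∀ y < s, g y = c) (hM : M.StandingAssumptions)
    (hθ : 0 < θ) {t : ℕ} (ht : t < M.T) {y : ℝ} (hy : y + θ < s) : M.gridSum θ t g y = c := by
  have := hM.isProb
  rw [LeftConst.gridSum_eq ⟨s, c, hg⟩ hM hθ ht]
  have : ∀ ω, g (y - M.roundedDemand θ t ω) = c := fun ω =>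
    hg _ (by linarith [neg_le_roundedDemand (M := M) hθ t ω])
  simp [this]

/-- The finite sums in the recursion of the error bounds are grid sums. -/
theorem sum_Icc_eq_gridSum {g : ℝ → ℝ} {s : ℝ} (hg : ∀ y < s, g y = 0) (hθ : 0 < θ) (t : ℕ)
    {y : ℝ} :
    ∑ m ∈ Finset.Icc (-1 : ℤ) ⌊(y - s) / θ⌋, g (y - m * θ) * M.f θ t m = M.gridSum θ t g y := by
  set q := ⌊(y - s) / θ⌋ with hq
  have hz : ∀ i ∉ Finset.range (q + 2).toNat,
      g (y - ((i : ℝ) - 1) * θ) * M.f θ t ((i : ℤ) - 1) = 0 := by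
    intro i hi
    have h1 : q + 1 ≤ (i : ℤ) - 1 := by
      have := Finset.mem_range.not.1 hi
      omega
    have h2 : (q : ℝ) + 1 ≤ (i : ℝ) - 1 := by exact_mod_cast h1
    have h3 : (y - s) / θ < (i : ℝ) - 1 := lt_of_lt_of_le (Int.lt_floor_add_one _) h2
    rw [div_lt_iff₀ hθ] at h3
    rw [hg _ (by linarith), zero_mul]
  rw [gridSum, tsum_eq_sum hz]
  refine (Finset.sum_nbij' (fun i : ℕ => (i : ℤ) - 1) (fun m : ℤ => (m + 1).toNat)
    ?_ ?_ ?_ ?_ ?_).symm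
  · intro i hi; have := Finset.mem_range.1 hi; rw [Finset.mem_Icc]; omega
  · intro m hm; have := Finset.mem_Icc.1 hm; rw [Finset.mem_range]; omega
  · intro i hi; omega
  · intro m hm; have := Finset.mem_Icc.1 hm; omega
  · intro i hi; push_cast; rfl

end InventorySystem

namespace InventorySystem

/-! ### Optimal ordering for a Lipschitz cost-to-go of linear growth -/

/-- `J` is Lipschitz continuous. -/
def IsLip (J : ℝ → ℝ) : Prop := ∃ L, 0 ≤ L ∧ ∀ x y, |J x - J y| ≤ L * |x - y|

theorem IsLip.continuous {J : ℝ → ℝ} (h : IsLip J) : Continuous J := by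
  obtain ⟨L, hL, h⟩ := h
  exact (LipschitzWith.of_dist_le_mul (K := L.toNNReal) fun x y => by
    rw [Real.coe_toNNReal _ hL]; exact h x y).continuous

theorem isLip_of_le {J : ℝ → ℝ} {L : ℝ} (hL : 0 ≤ L) (h₁ : ∀ x y, x ≤ y → J x ≤ J y + L * (y - x))
    (h₂ : ∀ x y, x ≤ y → J y ≤ J x + L * (y - x)) : IsLip J := by
  refine ⟨L, hL, fun x y => ?_⟩
  rcases le_total x y with h | h
  · rw [abs_sub_comm x y, abs_of_nonneg (sub_nonneg.2 h), abs_le]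
    constructor <;> linarith [h₁ x y h, h₂ x y h]
  · rw [abs_of_nonneg (sub_nonneg.2 h), abs_le]
    constructor <;> linarith [h₁ y x h, h₂ y x h]

theorem IsLip.exists_forall_le {J : ℝ → ℝ} (h : IsLip J) :
    ∃ L, 0 ≤ L ∧ ∀ x y, x ≤ y → J x ≤ J y + L * (y - x) ∧ J y ≤ J x + L * (y - x) := by
  obtain ⟨L, hL, h⟩ := h
  refine ⟨L, hL, fun x y hxy => ?_⟩
  have := h x y
  rw [abs_sub_comm x y, abs_of_nonneg (sub_nonneg.2 hxy), abs_le] at this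
  constructor <;> linarith

/-- Lipschitz continuous and growing at least linearly. -/
structure IsCostToGo (J : ℝ → ℝ) : Prop where
  lip : IsLip J
  growth : ∃ ε > 0, ∃ B, ∀ y, ε * |y| - B ≤ J y

/-- The optimal cost, when raising the level from `x` to `y > x` costs `K` and the cost-to-go from
level `y` is `J y`. -/
noncomputable def orderValue (K : ℝ) (J : ℝ → ℝ) (x : ℝ) : ℝ :=
  min (J x) (K + sInf (J '' Set.Ici x))

namespace IsCostToGo

variable {J : ℝ → ℝ}

theorem tendsto (h : IsCostToGo J) : Tendsto J (cocompact ℝ) atTop := by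
  obtain ⟨ε, hε, B, hB⟩ := h.growth
  refine tendsto_atTop_mono hB ?_
  exact tendsto_atTop_add_const_right _ _
    ((tendsto_norm_cocompact_atTop (E := ℝ)).const_mul_atTop hε)

theorem exists_argmin_Ici (h : IsCostToGo J) (x : ℝ) :
    ∃ y, x ≤ y ∧ ∀ w, x ≤ w → J y ≤ J w := by
  obtain ⟨y, hy, hmin⟩ := h.lip.continuous.continuousOn.exists_isMinOn' (isClosed_Ici (a := x))
    (Set.self_mem_Ici (a := x))
    ((h.tendsto.eventually_ge_atTop (J x)).filter_mono inf_le_left)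
  exact ⟨y, hy, fun w hw => hmin hw⟩

theorem sInf_image_le (h : IsCostToGo J) {x y : ℝ} (hxy : x ≤ y) : sInf (J '' Set.Ici x) ≤ J y := by
  obtain ⟨w, hw, hmin⟩ := h.exists_argmin_Ici x
  refine csInf_le ⟨J w, ?_⟩ ⟨y, hxy, rfl⟩
  rintro _ ⟨v, hv, rfl⟩
  exact hmin v hv

theorem orderValue_le (h : IsCostToGo J) {K : ℝ} {x y : ℝ} (hxy : x ≤ y) :
    orderValue K J x ≤ K * (if 0 < y - x then 1 else 0) + J y := by
  split_ifs with h1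
  · have := h.sInf_image_le hxy
    exact (min_le_right _ _).trans (by linarith)
  · obtain rfl : x = y := by linarith
    exact (min_le_left _ _).trans (by linarith)

/-- There is an optimal ordering rule that is Borel. -/
theorem exists_measurable_selector (h : IsCostToGo J) {K : ℝ} (hK : 0 ≤ K) :
    ∃ p : ℝ → ℝ, Measurable p ∧ (∀ x, x ≤ p x) ∧
      ∀ x, orderValue K J x = K * (if 0 < p x - x then 1 else 0) + J (p x) := by
  set A : ℝ → Set ℝ := fun x => {y | x ≤ y ∧ ∀ w, x ≤ w → J y ≤ J w} with hA
  have hcl : ∀ x, IsClosed (A x) := by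
    intro x
    have : A x = Set.Ici x ∩ ⋂ w ∈ Set.Ici x, {y | J y ≤ J w} := by
      ext y; simp [hA]
    rw [this]
    exact isClosed_Ici.inter (isClosed_biInter fun w _ =>
      isClosed_le h.lip.continuous continuous_const)
  have hbdd : ∀ x, BddAbove (A x) := by
    intro x
    obtain ⟨ε, hε, B, hB⟩ := h.growth
    refine ⟨(J x + B) / ε, fun y hy => ?_⟩
    rw [le_div_iff₀ hε]
    have h1 := hB y
    have h2 := hy.2 x le_rfl
    nlinarith [le_abs_self y]
  have hmem : ∀ x, sSup (A x) ∈ A x := fun x =>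
    (hcl x).csSup_mem (h.exists_argmin_Ici x) (hbdd x)
  -- The largest minimizer over [x, ∞) is non-decreasing in x, and this is what makes it Borel.
  have hmono : Monotone fun x => sSup (A x) := by
    intro x x' hx
    rcases lt_or_ge (sSup (A x)) x' with h1 | h1
    · exact h1.le.trans (hmem x').1
    · exact le_csSup (hbdd x') ⟨h1, fun w hw => (hmem x).2 w (hx.trans hw)⟩
  have hval : ∀ x, sInf (J '' Set.Ici x) = J (sSup (A x)) := fun x =>
    IsLeast.csInf_eq ⟨⟨_, (hmem x).1, rfl⟩, by rintro _ ⟨w, hw, rfl⟩; exact (hmem x).2 w hw⟩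
  have hset : MeasurableSet {x | J x ≤ K + J (sSup (A x))} :=
    measurableSet_le h.lip.continuous.measurable
      (measurable_const.add (h.lip.continuous.measurable.comp hmono.measurable))
  classical
  refine ⟨fun x => if J x ≤ K + J (sSup (A x)) then x else sSup (A x),
    Measurable.ite hset measurable_id hmono.measurable, fun x => ?_, fun x => ?_⟩
  · dsimp only
    split_ifs
    · exact le_rfl
    · exact (hmem x).1
  · dsimp only
    rw [orderValue, hval]
    by_cases h1 : J x ≤ K + J (sSup (A x))
    · simp [h1]
    · have h2 : x < sSup (A x) := by
        refine lt_of_le_of_ne (hmem x).1 fun h3 => h1 ?_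
        rw [← h3]; linarith
      simp only [if_neg h1]
      rw [min_eq_right (not_le.1 h1).le, if_pos (sub_pos.2 h2), mul_one]

theorem exists_orderValue_eq (h : IsCostToGo J) {K : ℝ} (hK : 0 ≤ K) (x : ℝ) :
    ∃ y, x ≤ y ∧ orderValue K J x = K * (if 0 < y - x then 1 else 0) + J y := by
  obtain ⟨p, _, hp, he⟩ := h.exists_measurable_selector hK
  exact ⟨p x, hp x, he x⟩

theorem orderValue_le_add (h : IsCostToGo J) {K : ℝ} (hK : 0 ≤ K) {a b : ℝ} (hab : a ≤ b) :
    orderValue K J a ≤ K + orderValue K J b := by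
  obtain ⟨y, hy, he⟩ := h.exists_orderValue_eq hK b
  have h1 := h.orderValue_le (K := K) (hab.trans hy)
  have h2 : K * (if 0 < y - a then 1 else 0) ≤ K := by split_ifs <;> linarith
  have h3 : 0 ≤ K * (if 0 < y - b then 1 else 0) := by split_ifs <;> linarith
  linarith

/-- Policies are copied between x ≤ y. From x one orders to the target used at y, or stays if y
stays. From y one orders to the target used at x if it exceeds y, and otherwise stays at y, which is
no farther from that target than from x. -/
theorem orderValue_isLip (h : IsCostToGo J) {K : ℝ} (hK : 0 ≤ K) : IsLip (orderValue K J) := by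
  obtain ⟨L, hL, hJ⟩ := h.lip.exists_forall_le
  refine isLip_of_le hL (fun x y hxy => ?_) fun x y hxy => ?_
  · obtain ⟨w, hw, he⟩ := h.exists_orderValue_eq hK y
    have h0 : 0 ≤ L * (y - x) := mul_nonneg hL (sub_nonneg.2 hxy)
    rcases hw.eq_or_lt with rfl | h1
    · rw [he, sub_self, if_neg (lt_irrefl 0), mul_zero, zero_add]
      exact (min_le_left _ _).trans (hJ x y hxy).1
    · have h2 := h.orderValue_le (K := K) (hxy.trans hw)
      rw [if_pos (sub_pos.2 (hxy.trans_lt h1))] at h2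
      rw [he, if_pos (sub_pos.2 h1)]
      linarith
  · obtain ⟨w, hw, he⟩ := h.exists_orderValue_eq hK x
    have h3 : 0 ≤ K * (if 0 < w - x then 1 else 0) := by split_ifs <;> linarith
    rcases lt_or_ge y w with h1 | h1
    · have h2 := h.orderValue_le (K := K) h1.le
      have h0 : 0 ≤ L * (y - x) := mul_nonneg hL (sub_nonneg.2 hxy)
      rw [if_pos (sub_pos.2 h1)] at h2
      rw [he, if_pos (sub_pos.2 (hxy.trans_lt h1))]
      linarith
    · have h2 : orderValue K J y ≤ J y := min_le_left _ _
      have h4 := (hJ w y h1).2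
      have h5 : L * (y - w) ≤ L * (y - x) := mul_le_mul_of_nonneg_left (by linarith) hL
      linarith

theorem exists_le_orderValue (h : IsCostToGo J) {K : ℝ} (hK : 0 ≤ K) :
    ∃ B, ∀ x, B ≤ orderValue K J x := by
  obtain ⟨ε, hε, B, hB⟩ := h.growth
  refine ⟨-B, fun x => ?_⟩
  obtain ⟨y, hy, he⟩ := h.exists_orderValue_eq hK x
  have h3 : 0 ≤ K * (if 0 < y - x then 1 else 0) := by split_ifs <;> linarith
  have := mul_nonneg hε.le (abs_nonneg y)
  linarith [hB y]

end IsCostToGo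

/-! ### The exact dynamic program -/

variable {Ω : Type*} [MeasurableSpace Ω] (M : InventorySystem Ω)

/-- The optimal cost from period `t` on, when `n` periods remain, plus `c_t x`. -/
noncomputable def optValue : ℕ → ℕ → ℝ → ℝ
  | 0, _ => fun _ => 0
  | n + 1, t => orderValue (M.K t) fun y =>
      M.C t y + M.α * ∫ ω, optValue n (t + 1) (y - M.D t ω) ∂M.P

/-- The optimal cost from level `y` after ordering in period `t`, followed by `n` more periods. -/
noncomputable def costToGo (n t : ℕ) (y : ℝ) : ℝ :=
  M.C t y + M.α * ∫ ω, M.optValue n (t + 1) (y - M.D t ω) ∂M.P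

theorem optValue_succ (n t : ℕ) : M.optValue (n + 1) t = orderValue (M.K t) (M.costToGo n t) := rfl

theorem costToGo_zero (t : ℕ) : M.costToGo 0 t = M.C t := by
  funext y; simp [costToGo, optValue]

/-! ### Regularity of the exact value functions. -/

variable {M} {γ : ℕ → ℝ}

theorem LipschitzCondition.isLip (hγ : M.LipschitzCondition γ) {t : ℕ} (ht : t < M.T) :
    IsLip (M.C t) := ⟨γ t, hγ t ht⟩

theorem IsLip.integrable_comp {u : ℝ → ℝ} (hu : IsLip u) {P : Measure Ω} [IsFiniteMeasure P]
    {X : Ω → ℝ} (hX : Integrable X P) : Integrable (fun ω => u (X ω)) P := by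
  have hc := hu.continuous
  obtain ⟨L, hL, h⟩ := hu
  refine Integrable.mono' (g := fun ω => |u 0| + L * |X ω|)
    ((integrable_const _).add (hX.abs.const_mul L))
    (hc.comp_aestronglyMeasurable hX.aestronglyMeasurable) (Eventually.of_forall fun ω => ?_)
  have h1 := h (X ω) 0
  rw [sub_zero] at h1
  have h2 := abs_sub_abs_le_abs_sub (u (X ω)) (u 0)
  rw [Real.norm_eq_abs]
  linarith

theorem integrable_comp_sub_demand {u : ℝ → ℝ} (hu : IsLip u) (hM : M.StandingAssumptions) {t : ℕ}
    (ht : t < M.T) (y : ℝ) : Integrable (fun ω => u (y - M.D t ω)) M.P := by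
  have := hM.isProb
  exact hu.integrable_comp ((integrable_const y).sub (hM.D_integrable t ht))

theorem isLip_integral_sub_demand {u : ℝ → ℝ} (hu : IsLip u) (hM : M.StandingAssumptions) {t : ℕ}
    (ht : t < M.T) : IsLip fun y => ∫ ω, u (y - M.D t ω) ∂M.P := by
  have := hM.isProb
  have hint := fun y => integrable_comp_sub_demand hu hM ht y
  obtain ⟨L, hL, h⟩ := hu.exists_forall_le
  have key : ∀ a b r, (∀ ω, u (a - M.D t ω) ≤ u (b - M.D t ω) + r) →
      ∫ ω, u (a - M.D t ω) ∂M.P ≤ ∫ ω, u (b - M.D t ω) ∂M.P + r := by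
    intro a b r hr
    have := integral_mono (hint a) ((hint b).add (integrable_const r)) hr
    simp only [Pi.add_apply] at this
    rwa [integral_add (hint b) (integrable_const r), integral_const, probReal_univ, one_smul] at this
  refine isLip_of_le hL (fun x y hxy => key _ _ _ fun ω => ?_) fun x y hxy => key _ _ _ fun ω => ?_
  · have := (h (x - M.D t ω) (y - M.D t ω) (by linarith)).1
    rwa [sub_sub_sub_cancel_right] at this
  · have := (h (x - M.D t ω) (y - M.D t ω) (by linarith)).2
    rwa [sub_sub_sub_cancel_right] at this

theorem IsLip.add {f g : ℝ → ℝ} (hf : IsLip f) (hg : IsLip g) {a : ℝ} :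
    IsLip fun y => f y + a * g y := by
  obtain ⟨L, hL, hf⟩ := hf
  obtain ⟨L', hL', hg⟩ := hg
  refine ⟨L + |a| * L', by positivity, fun x y => ?_⟩
  have h1 : f x + a * g x - (f y + a * g y) = (f x - f y) + a * (g x - g y) := by ring
  have h2 := abs_add_le (f x - f y) (a * (g x - g y))
  rw [abs_mul] at h2
  have h3 := mul_le_mul_of_nonneg_left (hg x y) (abs_nonneg a)
  rw [h1]
  linarith [hf x y]

/-- Backward induction: if the value of the next period is Lipschitz and bounded below, then the
cost-to-go inherits linear growth from C, and optimal ordering preserves both properties. The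
cost-to-go of period s = t - 1 is carried along because it feeds the next step. -/
theorem isLip_optValue_and_isCostToGo (hM : M.StandingAssumptions) (hγ : M.LipschitzCondition γ)
    (n : ℕ) : ∀ t, t + n = M.T → (IsLip (M.optValue n t) ∧ ∃ B, ∀ x, B ≤ M.optValue n t x) ∧
      ∀ s, s + 1 = t → IsCostToGo (M.costToGo n s) := by
  have := hM.isProb
  have step : ∀ n t, t + n = M.T → (IsLip (M.optValue n t) ∧ ∃ B, ∀ x, B ≤ M.optValue n t x) →
      ∀ s, s + 1 = t → IsCostToGo (M.costToGo n s) := by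
    rintro n t hT ⟨hlip, B, hB⟩ s rfl
    have hs : s < M.T := by omega
    refine ⟨(hγ.isLip hs).add (isLip_integral_sub_demand hlip hM hs), ?_⟩
    obtain ⟨ε, hε, B', hB'⟩ := exists_linear_growth (hγ.isLip hs).continuous (hM.C_convex s hs)
      (hM.C_coercive s hs)
    refine ⟨ε, hε, B' - M.α * B, fun y => ?_⟩
    have h1 : B ≤ ∫ ω, M.optValue n (s + 1) (y - M.D s ω) ∂M.P := by
      have := integral_mono (integrable_const B) (integrable_comp_sub_demand hlip hM hs y)
        fun ω => hB _
      simpa using this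
    have h2 := mul_le_mul_of_nonneg_left h1 hM.α_pos.le
    have := hB' y
    unfold costToGo
    linarith
  induction n with
  | zero =>
    intro t ht
    have h : IsLip (M.optValue 0 t) ∧ ∃ B, ∀ x, B ≤ M.optValue 0 t x :=
      ⟨⟨0, le_rfl, fun x y => by simp [optValue]⟩, 0, fun x => le_rfl⟩
    exact ⟨h, step 0 t ht h⟩
  | succ n ih =>
    intro t ht
    have hJ := (ih (t + 1) (by omega)).2 t rfl
    have hK := hM.K_nonneg t (by omega)
    have h : IsLip (M.optValue (n + 1) t) ∧ ∃ B, ∀ x, B ≤ M.optValue (n + 1) t x := by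
      rw [optValue_succ]
      exact ⟨hJ.orderValue_isLip hK, hJ.exists_le_orderValue hK⟩
    exact ⟨h, step _ t ht h⟩

theorem isLip_optValue (hM : M.StandingAssumptions) (hγ : M.LipschitzCondition γ) {n t : ℕ}
    (h : t + n = M.T) : IsLip (M.optValue n t) :=
  (isLip_optValue_and_isCostToGo hM hγ n t h).1.1

theorem isCostToGo_costToGo (hM : M.StandingAssumptions) (hγ : M.LipschitzCondition γ) {n t : ℕ}
    (h : t + n + 1 = M.T) : IsCostToGo (M.costToGo n t) :=
  (isLip_optValue_and_isCostToGo hM hγ n (t + 1) (by omega)).2 t rfl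

end InventorySystem

namespace InventorySystem

variable {Ω : Type*} [MeasurableSpace Ω] {M : InventorySystem Ω} {θ : ℝ} {γ : ℕ → ℝ}

/-! ### The reference points of a single period -/

theorem C_Cm_le (hM : M.StandingAssumptions) (hγ : M.LipschitzCondition γ) {t : ℕ} (ht : t < M.T)
    (x : ℝ) : M.C t (M.Cm t) ≤ M.C t x := by
  have hc := (hγ.isLip ht).continuous
  obtain ⟨ε, hε, B, hB⟩ := exists_linear_growth hc (hM.C_convex t ht) (hM.C_coercive t ht)
  have hcl : IsClosed {y | ∀ x, M.C t y ≤ M.C t x} := by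
    have : {y | ∀ x, M.C t y ≤ M.C t x} = ⋂ x, {y | M.C t y ≤ M.C t x} := by ext; simp
    rw [this]
    exact isClosed_iInter fun x => isClosed_le hc continuous_const
  have hb : BddBelow {y | ∀ x, M.C t y ≤ M.C t x} := by
    refine ⟨-((M.C t 0 + B) / ε), fun y hy => ?_⟩
    rw [neg_le, le_div_iff₀ hε]
    nlinarith [hB y, hy 0, neg_abs_le y]
  exact hcl.csInf_mem (exists_argmin hc (hM.C_coercive t ht)) hb x

theorem C_le_of_le_Cm (hM : M.StandingAssumptions) (hγ : M.LipschitzCondition γ) {t : ℕ}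
    (ht : t < M.T) {x y : ℝ} (hxy : x ≤ y) (hy : y ≤ M.Cm t) : M.C t y ≤ M.C t x :=
  le_of_convex_of_le_argmin (hM.C_convex t ht) (C_Cm_le hM hγ ht) hxy hy

theorem C_le_of_Cm_le (hM : M.StandingAssumptions) (hγ : M.LipschitzCondition γ) {t : ℕ}
    (ht : t < M.T) {x y : ℝ} (hx : M.Cm t ≤ x) (hxy : x ≤ y) : M.C t x ≤ M.C t y :=
  le_of_convex_of_argmin_le (hM.C_convex t ht) (C_Cm_le hM hγ ht) hx hxy

theorem Ybar_spec (hM : M.StandingAssumptions) (hγ : M.LipschitzCondition γ) {t : ℕ}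
    (ht : t < M.T) : M.Ybar t ≤ M.Cm t ∧ M.C t (M.Ybar t) = M.C t (M.Cm t) + M.K t := by
  have hc := (hγ.isLip ht).continuous
  have hK := hM.K_nonneg t ht
  have hcl : IsClosed {y | y ≤ M.Cm t ∧ M.C t y = M.C t (M.Cm t) + M.K t} :=
    isClosed_Iic.inter (isClosed_eq hc continuous_const)
  refine hcl.csSup_mem ?_ ⟨M.Cm t, fun y hy => hy.1⟩
  obtain ⟨a, ha, ha'⟩ := (((tendsto_atBot_of_coercive (hM.C_coercive t ht)).eventually_ge_atTop
    (M.C t (M.Cm t) + M.K t)).and (eventually_le_atBot (M.Cm t))).exists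
  obtain ⟨y, hy, he⟩ := intermediate_value_Icc' ha' hc.continuousOn
    (show M.C t (M.Cm t) + M.K t ∈ Set.Icc _ _ from ⟨by linarith, ha⟩)
  exact ⟨y, hy.2, he⟩

variable (M θ) in
/-- The largest grid point below `C^m_t`. -/
noncomputable def preMin (t : ℕ) : ℝ := ((⌈M.Cm t / θ⌉ - 1 : ℤ) : ℝ) * θ

theorem preMin_mem (t : ℕ) : M.preMin θ t ∈ grid θ := ⟨_, rfl⟩

theorem preMin_lt (hθ : 0 < θ) (t : ℕ) : M.preMin θ t < M.Cm t := by
  unfold preMin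
  rw [← lt_div_iff₀ hθ]
  push_cast
  linarith [Int.ceil_lt_add_one (M.Cm t / θ)]

theorem SU_spec (hM : M.StandingAssumptions) (hθ : 0 < θ) {t : ℕ} (ht : t < M.T) :
    M.SU θ t ∈ grid θ ∧ M.Cm t ≤ M.SU θ t ∧
      M.C t (M.preMin θ t) + M.K t < M.C t (M.SU θ t) := by
  refine sInf_mem_of_subset_grid hθ (A := {z | z ∈ grid θ ∧ M.Cm t ≤ z ∧
    M.C t (M.preMin θ t) + M.K t < M.C t z}) (fun z hz => hz.1) ?_ ⟨M.Cm t, fun z hz => hz.2.1⟩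
  obtain ⟨b, hb⟩ := eventually_atTop.1 ((tendsto_atTop_of_coercive
    (hM.C_coercive t ht)).eventually_gt_atTop (M.C t (M.preMin θ t) + M.K t))
  obtain ⟨z, hz, -, h⟩ := exists_grid_cell hθ (max b (M.Cm t))
  exact ⟨z, hz, (le_max_right _ _).trans h, hb z ((le_max_left _ _).trans h)⟩

theorem lowerPoint_spec (hθ : 0 < θ) (t : ℕ) (b : ℝ) :
    M.lowerPoint θ t b ∈ grid θ ∧ M.lowerPoint θ t b < min (b - θ) (M.Cm t) := by
  refine sSup_mem_of_subset_grid hθ (A := {z | z ∈ grid θ ∧ z < min (b - θ) (M.Cm t)})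
    (fun z hz => hz.1) ?_ ⟨_, fun z hz => hz.2.le⟩
  obtain ⟨z, hz, h, -⟩ := exists_grid_cell hθ (min (b - θ) (M.Cm t))
  exact ⟨z - θ, grid_sub hz, h⟩

theorem Ibar_succ_spec (hM : M.StandingAssumptions) (hθ : 0 < θ) (n : ℕ) {t : ℕ} (ht : t < M.T) :
    M.Ibar θ (n + 1) t - θ ∈ grid θ ∧
      M.Ibar θ (n + 1) t ≤ M.lowerPoint θ t (M.Ibar θ n (t + 1)) ∧
      M.C t (M.lowerPoint θ t (M.Ibar θ n (t + 1))) + M.K t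
        < M.C t (M.Ibar θ (n + 1) t - θ) := by
  set I := M.lowerPoint θ t (M.Ibar θ n (t + 1)) with hI
  have hIg : I ∈ grid θ := (lowerPoint_spec hθ t _).1
  have hmem : sSup {z | z ∈ grid θ ∧ z ≤ I ∧ M.C t I + M.K t < M.C t z} ∈
      {z | z ∈ grid θ ∧ z ≤ I ∧ M.C t I + M.K t < M.C t z} := by
    refine sSup_mem_of_subset_grid hθ (fun z hz => hz.1) ?_ ⟨I, fun z hz => hz.2.1⟩
    obtain ⟨b, hb⟩ := eventually_atBot.1 ((tendsto_atBot_of_coercive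
      (hM.C_coercive t ht)).eventually_gt_atTop (M.C t I + M.K t))
    obtain ⟨z, hz, h, -⟩ := exists_grid_cell hθ (min b I)
    exact ⟨z - θ, grid_sub hz, h.le.trans (min_le_right _ _), hb _ (h.le.trans (min_le_left _ _))⟩
  have hval : M.Ibar θ (n + 1) t - θ
      = sSup {z | z ∈ grid θ ∧ z ≤ I ∧ M.C t I + M.K t < M.C t z} := add_sub_cancel_right _ _
  rw [← hval] at hmem
  refine ⟨hmem.1, ?_, hmem.2.2⟩
  -- Since K ≥ 0, the point I itself does not satisfy the strict inequality, so adding θ does not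
  -- overshoot I.
  have hlt : M.Ibar θ (n + 1) t - θ < I := by
    refine lt_of_le_of_ne hmem.2.1 fun h => ?_
    have := hmem.2.2
    rw [h] at this
    linarith [hM.K_nonneg t ht]
  linarith [grid_le_sub hθ hmem.1 hIg hlt]

/-! ### The structure of the approximate policy -/

theorem gridSum_le_add {g₁ g₂ : ℝ → ℝ} (h₁ : LeftConst g₁) (h₂ : LeftConst g₂)
    (hM : M.StandingAssumptions) (hθ : 0 < θ) {t : ℕ} (ht : t < M.T) {y₁ y₂ r : ℝ}
    (h : ∀ ω, g₁ (y₁ - M.roundedDemand θ t ω) ≤ g₂ (y₂ - M.roundedDemand θ t ω) + r) :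
    M.gridSum θ t g₁ y₁ ≤ M.gridSum θ t g₂ y₂ + r := by
  have := hM.isProb
  obtain ⟨s, c, hs⟩ := h₂
  have h₂' : LeftConst fun y => g₂ y + r := ⟨s, c + r, fun y hy => by simp only [hs y hy]⟩
  have h₂ : LeftConst g₂ := ⟨s, c, hs⟩
  have := gridSum_mono h₁ h₂' hM hθ ht (y₁ := y₁) (y₂ := y₂) h
  rw [h₂'.gridSum_eq hM hθ ht, integral_add (h₂.integrable hM hθ ht _) (integrable_const r),
    ← h₂.gridSum_eq hM hθ ht] at this
  simpa using this

/-- Subtracting the rounded demand keeps a triple of grid points in the grid with the same spacing,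
so the inequality can be integrated. -/
theorem gridSum_kConvexOn {g : ℝ → ℝ} {K : ℝ} (hg : LeftConst g) (hc : KConvexOn (grid θ) K g)
    (hM : M.StandingAssumptions) (hθ : 0 < θ) {t : ℕ} (ht : t < M.T) :
    KConvexOn (grid θ) K (M.gridSum θ t g) := by
  intro a ha b hb c hc' hab hbc
  have := hM.isProb
  have hi := hg.integrable hM hθ ht
  simp only [hg.gridSum_eq hM hθ ht]
  have hi' : Integrable (fun ω => (b - a) * K + (b - a) * g (c - M.roundedDemand θ t ω)) M.P :=
    (integrable_const _).add ((hi c).const_mul _)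
  have h : ∫ ω, (c - a) * g (b - M.roundedDemand θ t ω) ∂M.P ≤
      ∫ ω, ((c - b) * g (a - M.roundedDemand θ t ω)
        + ((b - a) * K + (b - a) * g (c - M.roundedDemand θ t ω))) ∂M.P := by
    refine integral_mono ((hi b).const_mul _)
      (((hi a).const_mul _).add hi') fun ω => ?_
    have := hc _ (M.grid_sub_roundedDemand θ ha t ω) _ (M.grid_sub_roundedDemand θ hb t ω) _
      (M.grid_sub_roundedDemand θ hc' t ω) (by linarith) (by linarith)
    simp only [sub_sub_sub_cancel_right] at this
    dsimp only
    linarith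
  rw [integral_const_mul, integral_add ((hi a).const_mul _) hi', integral_add (integrable_const _)
    ((hi c).const_mul _), integral_const, probReal_univ, one_smul, integral_const_mul,
    integral_const_mul] at h
  linarith

variable (M θ) in
/-- The function `V_t`, with the two indices of the recursion. -/
noncomputable def Vrec (n t : ℕ) : ℝ → ℝ := M.Vof θ n t (M.Hrec θ n t)

theorem leftConst_Vrec (n t : ℕ) : LeftConst (M.Vrec θ n t) := leftConst_thresholdValue _ _ _ _

theorem Vrec_of_lt {n t : ℕ} {y : ℝ} (h : y < M.srec θ n t) :
    M.Vrec θ n t y = M.Hrec θ n t (M.Srec θ n t) + M.K t := if_pos h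

theorem Vrec_of_le {n t : ℕ} {y : ℝ} (h : M.srec θ n t ≤ y) :
    M.Vrec θ n t y = M.Hrec θ n t y := if_neg h.not_gt

theorem Hrec_succ (n t : ℕ) (y : ℝ) :
    M.Hrec θ (n + 1) t y = M.C t y + M.α * M.gridSum θ t (M.Vrec θ n (t + 1)) y := rfl

theorem isThreshold_zero (hM : M.StandingAssumptions) (hγ : M.LipschitzCondition γ) {t : ℕ}
    (ht : t < M.T) :
    IsThreshold Set.univ (M.K t) (M.Srec θ 0 t) (M.srec θ 0 t) (M.Hrec θ 0 t) where
  K_nonneg := hM.K_nonneg t ht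
  mem := Set.mem_univ _
  le := (Ybar_spec hM hγ ht).1
  isMin w _ := C_Cm_le hM hγ ht w
  between b _ hb hb' := by
    have h1 : M.C t b ≤ M.C t (M.Ybar t) := C_le_of_le_Cm hM hγ ht hb hb'
    rw [(Ybar_spec hM hγ ht).2, add_comm] at h1
    exact h1
  kConvex := (hM.C_convex t ht).kConvexOn _ (hM.K_nonneg t ht)

/-- The properties of `V_t` that the preceding period relies on. -/
structure IsRegular (M : InventorySystem Ω) (θ : ℝ) (n t : ℕ) : Prop where
  kConvex : KConvexOn (grid θ) (M.K t) (M.Vrec θ n t)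
  le_add : ∀ a ∈ grid θ, ∀ b ∈ grid θ, a ≤ b → M.Vrec θ n t a ≤ M.K t + M.Vrec θ n t b
  Ibar_le : M.Ibar θ n t ≤ M.srec θ n t

/-- The properties of the approximate policy before the last period. -/
structure IsOptimalOnGrid (M : InventorySystem Ω) (θ : ℝ) (n t : ℕ) : Prop where
  threshold : IsThreshold (grid θ) (M.K t) (M.Srec θ (n + 1) t) (M.srec θ (n + 1) t)
    (M.Hrec θ (n + 1) t)
  s_mem : M.srec θ (n + 1) t ∈ grid θ
  Ibar_le : M.Ibar θ (n + 1) t ≤ M.srec θ (n + 1) t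
  S_le : M.Srec θ (n + 1) t ≤ M.SU θ t
  le_of_lt : ∀ z ∈ grid θ, z < M.srec θ (n + 1) t →
    M.Hrec θ (n + 1) t (M.Srec θ (n + 1) t) + M.K t ≤ M.Hrec θ (n + 1) t z

theorem isRegular_zero (hM : M.StandingAssumptions) (hγ : M.LipschitzCondition γ) {t : ℕ}
    (ht : t < M.T) : IsRegular M θ 0 t where
  kConvex := fun a _ b _ c _ => (isThreshold_zero hM hγ ht).value_kConvex a trivial b trivial c
    trivial
  le_add := fun _ _ _ _ hab => (isThreshold_zero hM hγ ht).value_le_add trivial trivial hab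
  Ibar_le := le_rfl

theorem IsOptimalOnGrid.isRegular {n t : ℕ} (h : IsOptimalOnGrid M θ n t) :
    IsRegular M θ (n + 1) t where
  kConvex := h.threshold.value_kConvex
  le_add := fun _ ha _ hb hab => h.threshold.value_le_add ha hb hab
  Ibar_le := h.Ibar_le

/-- Below I the future cost is constant and C decreases towards its minimizer; beyond S^U the
one-period loss already exceeds K, while the future gain is at most α K_{t+1} ≤ K_t. Hence a
minimizer on the window [I, S^U] is global on the grid. -/
theorem IsRegular.isOptimalOnGrid {n t : ℕ} (h : IsRegular M θ n (t + 1))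
    (hM : M.StandingAssumptions) (hγ : M.LipschitzCondition γ) (hθ : 0 < θ) (hT : t + 1 < M.T) :
    IsOptimalOnGrid M θ n t := by
  have ht : t < M.T := by omega
  have hK := hM.K_nonneg t ht
  have hαK := hM.K_decr t hT
  have hα := hM.α_pos
  have hVc := leftConst_Vrec (M := M) (θ := θ) n (t + 1)
  set V := M.Vrec θ n (t + 1) with hV
  set H := M.Hrec θ (n + 1) t with hH
  set I := M.lowerPoint θ t (M.Ibar θ n (t + 1)) with hI
  set S := M.Srec θ (n + 1) t with hS
  set s := M.srec θ (n + 1) t with hs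
  obtain ⟨hIg, hIlt⟩ := lowerPoint_spec (M := M) hθ t (M.Ibar θ n (t + 1))
  obtain ⟨hbg, hbI, hbC⟩ := Ibar_succ_spec hM hθ n ht
  obtain ⟨hUg, hCU, hUC⟩ := SU_spec hM hθ ht
  rw [← hI] at hIg hIlt hbI hbC
  have hI1 : I < M.Ibar θ n (t + 1) - θ := hIlt.trans_le (min_le_left _ _)
  have hI2 : I < M.Cm t := hIlt.trans_le (min_le_right _ _)
  -- As R ≥ -θ and I < Ī_{t+1} - θ ≤ s_{t+1} - θ, every level y - R lies in the constant part of the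
  -- next V.
  obtain ⟨v, hv⟩ : ∃ v, ∀ y ≤ I, H y = M.C t y + M.α * v := by
    refine ⟨M.Hrec θ n (t + 1) (M.Srec θ n (t + 1)) + M.K (t + 1), fun y hy => ?_⟩
    rw [hH, Hrec_succ, gridSum_of_lt (fun w hw => Vrec_of_lt hw) hM hθ ht]
    linarith [h.Ibar_le]
  have hpre : I ≤ M.preMin θ t := by
    obtain ⟨m, hm⟩ := hIg
    rw [hm] at hI2 ⊢
    rw [← lt_div_iff₀ hθ] at hI2
    refine mul_le_mul_of_nonneg_right ?_ hθ.le
    have : m < ⌈M.Cm t / θ⌉ := Int.lt_ceil.2 hI2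
    exact_mod_cast (by omega : m ≤ ⌈M.Cm t / θ⌉ - 1)
  have hpreU : M.preMin θ t ≤ M.SU θ t := (preMin_lt hθ t).le.trans hCU
  have hmem : S ∈ {z | z ∈ grid θ ∧ I ≤ z ∧ z ≤ M.SU θ t ∧
      ∀ w ∈ grid θ, I ≤ w → w ≤ M.SU θ t → H z ≤ H w} := by
    refine sSup_mem_of_subset_grid hθ (fun z hz => hz.1) ?_ ⟨M.SU θ t, fun z hz => hz.2.2.1⟩
    obtain ⟨z, h1, h2, h3, h4⟩ := exists_grid_min hθ H hIg (hpre.trans hpreU)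
    exact ⟨z, h1, h2, h3, h4⟩
  obtain ⟨hSg, hIS, hSU, hSmin⟩ := hmem
  have hglob : ∀ w ∈ grid θ, H S ≤ H w := by
    intro w hw
    rcases lt_or_ge w I with h1 | h1
    · refine (hSmin I hIg le_rfl (hpre.trans hpreU)).trans ?_
      rw [hv I le_rfl, hv w h1.le]
      linarith [C_le_of_le_Cm hM hγ ht h1.le hI2.le]
    rcases le_or_gt w (M.SU θ t) with h2 | h2
    · exact hSmin w hw h1 h2
    · refine (hSmin _ (preMin_mem t) hpre hpreU).trans ?_
      have h3 := gridSum_le_add hVc hVc hM hθ ht (y₁ := M.preMin θ t) (y₂ := w)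
        (r := M.K (t + 1)) fun ω => by
          rw [add_comm]
          exact h.le_add _ (M.grid_sub_roundedDemand θ (preMin_mem t) t ω) _
            (M.grid_sub_roundedDemand θ hw t ω) (by linarith)
      have h4 := mul_le_mul_of_nonneg_left h3 hα.le
      have h5 := C_le_of_Cm_le hM hγ ht hCU h2.le
      rw [hH, Hrec_succ, Hrec_succ]
      linarith
  have hs_spec : s ∈ grid θ ∧ M.Ibar θ (n + 1) t ≤ s ∧ s ≤ S ∧ H s ≤ H S + M.K t ∧
      ∀ z ∈ grid θ, M.Ibar θ (n + 1) t ≤ z → z < s → H S + M.K t ≤ H z := by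
    by_cases hK0 : M.K t = 0
    · have hsS : s = S := if_pos hK0
      rw [hsS, hK0]
      exact ⟨hSg, hbI.trans hIS, le_rfl, by linarith, fun z hz _ _ => by linarith [hglob z hz]⟩
    · have hsS : s = sInf {z | z ∈ grid θ ∧ M.Ibar θ (n + 1) t ≤ z ∧ z ≤ S ∧
          H z ≤ H S + M.K t} := if_neg hK0
      have hbb : BddBelow {z | z ∈ grid θ ∧ M.Ibar θ (n + 1) t ≤ z ∧ z ≤ S ∧
          H z ≤ H S + M.K t} := ⟨_, fun z hz => hz.2.1⟩
      have hm := sInf_mem_of_subset_grid hθ (A := {z | z ∈ grid θ ∧ M.Ibar θ (n + 1) t ≤ z ∧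
        z ≤ S ∧ H z ≤ H S + M.K t}) (fun z hz => hz.1)
        ⟨S, hSg, hbI.trans hIS, le_rfl, by linarith⟩ hbb
      rw [← hsS] at hm
      refine ⟨hm.1, hm.2.1, hm.2.2.1, hm.2.2.2, fun z hz h1 h2 => ?_⟩
      by_contra hcon
      rw [hsS] at h2
      exact h2.not_ge (csInf_le hbb ⟨hz, h1, (hsS ▸ h2).le.trans hm.2.2.1, (not_le.1 hcon).le⟩)
  obtain ⟨hsg, hbs, hsS, hHs, hbelow⟩ := hs_spec
  -- C is convex, and the averaged V contributes α K_{t+1}, which is at most K_t.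
  have hHc : KConvexOn (grid θ) (M.K t) H := by
    intro a ha b hb c hc hab hbc
    have h1 := (hM.C_convex t ht).kConvexOn (grid θ) le_rfl a ha b hb c hc hab hbc
    have h2 := mul_le_mul_of_nonneg_left
      (gridSum_kConvexOn hVc h.kConvex hM hθ ht a ha b hb c hc hab hbc) hα.le
    have h3 := mul_le_mul_of_nonneg_left hαK (sub_nonneg.2 hab)
    simp only [hH, Hrec_succ]
    rw [← hV]
    linarith
  refine ⟨⟨hK, hSg, hsS, hglob, fun b hb hsb hbS => ?_, hHc⟩, hsg, hbs, hSU, fun z hz hzs => ?_⟩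
  · rcases hsS.eq_or_lt with h1 | h1
    · obtain rfl : b = S := le_antisymm hbS (h1 ▸ hsb)
      linarith
    · have h2 := hHc s hsg b hb S hSg hsb hbS
      have h3 := mul_le_mul_of_nonneg_left hHs (sub_nonneg.2 hbS)
      have h4 : (S - s) * H b ≤ (S - s) * (M.K t + H S) := by linarith
      exact le_of_mul_le_mul_left h4 (sub_pos.2 h1)
  -- Below Ī, H differs from C by the same constant as at I, and C exceeds its value at I by more
  -- than K. Starting the search for s at Ī is therefore harmless.
  · rcases lt_or_ge z (M.Ibar θ (n + 1) t) with h1 | h1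
    · have h2 : z ≤ M.Ibar θ (n + 1) t - θ := by
        have := grid_le_sub hθ hz (grid_add hbg) (by linarith)
        linarith
      have h3 := C_le_of_le_Cm hM hγ ht h2 (by linarith)
      have h4 := hglob I hIg
      rw [hv I le_rfl] at h4
      have h5 := hv z (by linarith)
      change H S + M.K t ≤ H z
      linarith
    · exact hbelow z hz h1 hzs

theorem isRegular (hM : M.StandingAssumptions) (hγ : M.LipschitzCondition γ) (hθ : 0 < θ) (n : ℕ) :
    ∀ t, t + n < M.T → IsRegular M θ n t := by
  induction n with
  | zero => exact fun t ht => isRegular_zero hM hγ ht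
  | succ n ih =>
    exact fun t ht => ((ih (t + 1) (by omega)).isOptimalOnGrid hM hγ hθ (by omega)).isRegular

theorem isOptimalOnGrid (hM : M.StandingAssumptions) (hγ : M.LipschitzCondition γ) (hθ : 0 < θ)
    {n t : ℕ} (h : t + n + 1 < M.T) : IsOptimalOnGrid M θ n t :=
  (isRegular hM hγ hθ n (t + 1) (by omega)).isOptimalOnGrid hM hγ hθ (by omega)

end InventorySystem

namespace InventorySystem

variable {Ω : Type*} [MeasurableSpace Ω] {M : InventorySystem Ω} {θ : ℝ} {γ : ℕ → ℝ}

/-! ### The functions `ψ`, `φ` and `ω` -/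

variable (M θ γ) in
/-- `φ_t`. -/
noncomputable def phi (n t : ℕ) : ℝ → ℝ → ℝ := M.phiOf θ n t (M.psi θ γ n t)

variable (M θ γ) in
/-- `φ̄_t`. -/
noncomputable def phiBar (n t : ℕ) : ℝ → ℝ → ℝ := M.phiBarOf θ n t (M.psiBar θ γ n t)

theorem phi_of_lt {n t : ℕ} {x y : ℝ} (h : y < M.srec θ n t) : M.phi θ γ n t x y = 0 := by
  cases n <;> exact if_pos h

theorem phiBar_of_lt {n t : ℕ} {x y : ℝ} (h : y < M.srec θ n t) : M.phiBar θ γ n t x y = 0 := by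
  cases n <;> exact if_pos h

theorem leftConst_phi (n t : ℕ) (x : ℝ) : LeftConst (M.phi θ γ n t x) :=
  ⟨M.srec θ n t, 0, fun _ h => phi_of_lt h⟩

theorem leftConst_phiBar (n t : ℕ) (x : ℝ) : LeftConst (M.phiBar θ γ n t x) :=
  ⟨M.srec θ n t, 0, fun _ h => phiBar_of_lt h⟩

theorem phi_zero_of_le {t : ℕ} {x y : ℝ} (h : M.srec θ 0 t ≤ y) :
    M.phi θ γ 0 t x y = γ t * x := if_neg h.not_gt

theorem phiBar_zero_of_le {t : ℕ} {x y : ℝ} (h : M.srec θ 0 t ≤ y) :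
    M.phiBar θ γ 0 t x y = γ t * x := if_neg h.not_gt

/-- The two remaining cases of the definition merge into a minimum, from which monotonicity in both
arguments can be read off. -/
theorem phi_succ_of_le {n t : ℕ} {x y : ℝ} (h : M.srec θ (n + 1) t ≤ y) :
    M.phi θ γ (n + 1) t x y = M.psi θ γ (n + 1) t (min x (y - M.srec θ (n + 1) t)) y := by
  refine (if_neg h.not_gt).trans ?_
  split_ifs with h1
  · rw [min_eq_right (by linarith)]
  · rw [min_eq_left (by linarith)]

theorem psi_succ (hM : M.StandingAssumptions) (hθ : 0 < θ) (n : ℕ) {t : ℕ} (ht : t < M.T)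
    (x y : ℝ) : M.psi θ γ (n + 1) t x y
      = γ t * x + M.α * M.gridSum θ t (M.phi θ γ n (t + 1) x) y := by
  rw [psi]
  dsimp only
  split_ifs with h
  · rw [gridSum_of_lt (fun _ h => phi_of_lt h) hM hθ ht (lt_sub_iff_add_lt.1 h)]
    ring
  · rw [← sum_Icc_eq_gridSum (fun _ h => phi_of_lt h) hθ t]
    rfl

theorem psiBar_succ (hM : M.StandingAssumptions) (hθ : 0 < θ) (n : ℕ) {t : ℕ} (ht : t < M.T)
    (x y : ℝ) : M.psiBar θ γ (n + 1) t x y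
      = γ t * x + M.α * M.gridSum θ t (M.phiBar θ γ n (t + 1) x) y := by
  rw [psiBar]
  dsimp only
  split_ifs with h
  · rw [gridSum_of_lt (fun _ h => phiBar_of_lt h) hM hθ ht (lt_sub_iff_add_lt.1 h)]
    ring
  · rw [← sum_Icc_eq_gridSum (fun _ h => phiBar_of_lt h) hθ t]
    rfl

/-- Non-negativity and monotonicity in both arguments, for non-negative first arguments. -/
structure IsMonoBound (p : ℝ → ℝ → ℝ) : Prop where
  nonneg : ∀ x y, 0 ≤ x → 0 ≤ p x y
  mono : ∀ x x' y y', 0 ≤ x → x ≤ x' → y ≤ y' → p x y ≤ p x' y'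

theorem isMonoBound_phi_zero (hγ : M.LipschitzCondition γ) {t : ℕ} (ht : t < M.T) :
    IsMonoBound (M.phi θ γ 0 t) := by
  have h0 : ∀ x y, 0 ≤ x → 0 ≤ M.phi θ γ 0 t x y := by
    intro x y hx
    rcases lt_or_ge y (M.srec θ 0 t) with h | h
    · rw [phi_of_lt h]
    · rw [phi_zero_of_le h]; exact mul_nonneg (hγ t ht).1 hx
  refine ⟨h0, fun x x' y y' hx hxx hyy => ?_⟩
  rcases lt_or_ge y (M.srec θ 0 t) with h | h
  · rw [phi_of_lt h]; exact h0 x' y' (hx.trans hxx)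
  · rw [phi_zero_of_le h, phi_zero_of_le (h.trans hyy)]
    exact mul_le_mul_of_nonneg_left hxx (hγ t ht).1

theorem IsMonoBound.phi {n t : ℕ} (h : IsMonoBound (M.psi θ γ (n + 1) t)) :
    IsMonoBound (M.phi θ γ (n + 1) t) := by
  have h0 : ∀ x y, 0 ≤ x → 0 ≤ M.phi θ γ (n + 1) t x y := by
    intro x y hx
    rcases lt_or_ge y (M.srec θ (n + 1) t) with h1 | h1
    · rw [phi_of_lt h1]
    · rw [phi_succ_of_le h1]; exact h.nonneg _ _ (le_min hx (sub_nonneg.2 h1))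
  refine ⟨h0, fun x x' y y' hx hxx hyy => ?_⟩
  rcases lt_or_ge y (M.srec θ (n + 1) t) with h1 | h1
  · rw [phi_of_lt h1]; exact h0 x' y' (hx.trans hxx)
  · rw [phi_succ_of_le h1, phi_succ_of_le (h1.trans hyy)]
    exact h.mono _ _ _ _ (le_min hx (sub_nonneg.2 h1)) (min_le_min hxx (by linarith)) hyy

theorem IsMonoBound.psi {n t : ℕ} (h : IsMonoBound (M.phi θ γ n (t + 1)))
    (hM : M.StandingAssumptions) (hγ : M.LipschitzCondition γ) (hθ : 0 < θ) (ht : t < M.T) :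
    IsMonoBound (M.psi θ γ (n + 1) t) := by
  refine ⟨fun x y hx => ?_, fun x x' y y' hx hxx hyy => ?_⟩
  · rw [psi_succ hM hθ n ht]
    exact add_nonneg (mul_nonneg (hγ t ht).1 hx) (mul_nonneg hM.α_pos.le
      (gridSum_nonneg (leftConst_phi _ _ _) hM hθ ht fun ω => h.nonneg _ _ hx))
  · rw [psi_succ hM hθ n ht, psi_succ hM hθ n ht]
    exact add_le_add (mul_le_mul_of_nonneg_left hxx (hγ t ht).1)
      (mul_le_mul_of_nonneg_left (gridSum_mono (leftConst_phi _ _ _) (leftConst_phi _ _ _) hM hθ ht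
        fun ω => h.mono _ _ _ _ hx hxx (by linarith)) hM.α_pos.le)

theorem isMonoBound_phi (hM : M.StandingAssumptions) (hγ : M.LipschitzCondition γ) (hθ : 0 < θ)
    (n : ℕ) : ∀ t, t + n < M.T → IsMonoBound (M.phi θ γ n t) := by
  induction n with
  | zero => exact fun t ht => isMonoBound_phi_zero hγ ht
  | succ n ih => exact fun t ht => ((ih (t + 1) (by omega)).psi hM hγ hθ (by omega)).phi

/-- An increase of the inventory level by at most `x` raises `V_t` by at most `φ_t(x, ·)`. -/
theorem Vrec_sub_le_phi (hM : M.StandingAssumptions) (hγ : M.LipschitzCondition γ) (hθ : 0 < θ)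
    (n : ℕ) : ∀ t, t + n < M.T → ∀ x a b, a ≤ b → b - a ≤ x →
      M.Vrec θ n t b - M.Vrec θ n t a ≤ M.phi θ γ n t x b := by
  have hC : ∀ t, t < M.T → ∀ x a b, a ≤ b → b - a ≤ x → M.C t b - M.C t a ≤ γ t * x := by
    intro t ht x a b hab hx
    have h1 := le_of_abs_le ((hγ t ht).2 b a)
    rw [abs_of_nonneg (sub_nonneg.2 hab)] at h1
    exact h1.trans (mul_le_mul_of_nonneg_left hx (hγ t ht).1)
  induction n with
  | zero =>
    intro t ht x a b hab hx
    rcases lt_or_ge b (M.srec θ 0 t) with h1 | h1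
    · rw [Vrec_of_lt h1, Vrec_of_lt (hab.trans_lt h1), phi_of_lt h1, sub_self]
    rw [Vrec_of_le h1, phi_zero_of_le h1]
    rcases lt_or_ge a (M.srec θ 0 t) with h2 | h2
    · have h3 : M.Hrec θ 0 t (M.srec θ 0 t) = M.Hrec θ 0 t (M.Srec θ 0 t) + M.K t :=
        (Ybar_spec hM hγ ht).2
      rw [Vrec_of_lt h2, ← h3]
      exact hC t ht x _ _ h1 (by linarith)
    · rw [Vrec_of_le h2]
      exact hC t ht x a b hab hx
  | succ n ih =>
    intro t ht x a b hab hx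
    have hH : ∀ x a b, a ≤ b → b - a ≤ x →
        M.Hrec θ (n + 1) t b - M.Hrec θ (n + 1) t a ≤ M.psi θ γ (n + 1) t x b := by
      intro x a b hab hx
      have ht' : t < M.T := by omega
      have h1 : M.gridSum θ t (M.Vrec θ n (t + 1)) b - M.gridSum θ t (M.Vrec θ n (t + 1)) a ≤
          M.gridSum θ t (M.phi θ γ n (t + 1) x) b := by
        have hV := leftConst_Vrec (M := M) (θ := θ) n (t + 1)
        have hφ := leftConst_phi (M := M) (θ := θ) (γ := γ) n (t + 1) x
        rw [hV.gridSum_eq hM hθ ht', hV.gridSum_eq hM hθ ht', hφ.gridSum_eq hM hθ ht',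
          ← integral_sub (hV.integrable hM hθ ht' _) (hV.integrable hM hθ ht' _)]
        exact integral_mono ((hV.integrable hM hθ ht' _).sub (hV.integrable hM hθ ht' _))
          (hφ.integrable hM hθ ht' _)
          fun ω => ih (t + 1) (by omega) x _ _ (by linarith) (by linarith)
      have h2 := mul_le_mul_of_nonneg_left h1 hM.α_pos.le
      have h3 := hC t ht' x a b hab hx
      rw [psi_succ hM hθ n ht', Hrec_succ, Hrec_succ]
      linarith
    have hopt := isOptimalOnGrid hM hγ hθ (n := n) (t := t) (by omega)
    rcases lt_or_ge b (M.srec θ (n + 1) t) with h1 | h1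
    · rw [Vrec_of_lt h1, Vrec_of_lt (hab.trans_lt h1), phi_of_lt h1, sub_self]
    rw [Vrec_of_le h1, phi_succ_of_le h1]
    rcases lt_or_ge a (M.srec θ (n + 1) t) with h2 | h2
    -- Below s the value is H(S) + K ≥ H(s), so only the stretch from s to b can raise V; this
    -- explains the cap y - s in φ.
    · rw [Vrec_of_lt h2]
      have h3 := hopt.threshold.between _ hopt.s_mem le_rfl hopt.threshold.le
      have h4 := hH _ _ b h1 (le_min (by linarith) le_rfl : _ ≤ min x (b - M.srec θ (n + 1) t))
      linarith
    · rw [Vrec_of_le h2]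
      exact hH _ _ _ hab (le_min hx (by linarith))

/-! ### Bounds on the grid -/

/-- On the grid with step θ the modified case occurs only at z = s, where its first argument z - s +
θ equals θ. This is the effect of the extra θ in φ̄. -/
theorem phiBar_succ_of_le {n t : ℕ} {z : ℝ} (hθ : 0 < θ) (hs : M.srec θ (n + 1) t ∈ grid θ)
    (hz : z ∈ grid θ) (h : M.srec θ (n + 1) t ≤ z) :
    M.phiBar θ γ (n + 1) t θ z = M.psiBar θ γ (n + 1) t θ z := by
  refine (if_neg h.not_gt).trans ?_
  split_ifs with h1
  · have h2 : z = M.srec θ (n + 1) t := by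
      rcases h.eq_or_lt with h2 | h2
      · exact h2.symm
      · linarith [grid_le_sub hθ hs hz h2]
    rw [h2, sub_self, zero_add]
  · rfl

/-- Non-negativity and monotonicity on the grid. -/
structure IsMonoOnGrid (θ : ℝ) (g : ℝ → ℝ) : Prop where
  nonneg : ∀ z ∈ grid θ, 0 ≤ g z
  mono : ∀ z ∈ grid θ, ∀ w ∈ grid θ, z ≤ w → g z ≤ g w

theorem isMonoOnGrid_of_threshold {g h : ℝ → ℝ} {s : ℝ} (h₁ : ∀ z < s, g z = 0)
    (h₂ : ∀ z ∈ grid θ, s ≤ z → g z = h z) (hh : IsMonoOnGrid θ h) : IsMonoOnGrid θ g := by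
  have h0 : ∀ z ∈ grid θ, 0 ≤ g z := by
    intro z hz
    rcases lt_or_ge z s with h3 | h3
    · rw [h₁ z h3]
    · rw [h₂ z hz h3]; exact hh.nonneg z hz
  refine ⟨h0, fun z hz w hw hzw => ?_⟩
  rcases lt_or_ge z s with h3 | h3
  · rw [h₁ z h3]; exact h0 w hw
  · rw [h₂ z hz h3, h₂ w hw (h3.trans hzw)]; exact hh.mono z hz w hw hzw

theorem IsMonoOnGrid.psiBar {n t : ℕ} (h : IsMonoOnGrid θ (M.phiBar θ γ n (t + 1) θ))
    (hM : M.StandingAssumptions) (hγ : M.LipschitzCondition γ) (hθ : 0 < θ) (ht : t < M.T) :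
    IsMonoOnGrid θ (M.psiBar θ γ (n + 1) t θ) := by
  refine ⟨fun z hz => ?_, fun z hz w hw hzw => ?_⟩
  · rw [psiBar_succ hM hθ n ht]
    exact add_nonneg (mul_nonneg (hγ t ht).1 hθ.le) (mul_nonneg hM.α_pos.le
      (gridSum_nonneg (leftConst_phiBar _ _ _) hM hθ ht
        fun ω => h.nonneg _ (M.grid_sub_roundedDemand θ hz t ω)))
  · rw [psiBar_succ hM hθ n ht, psiBar_succ hM hθ n ht]
    exact add_le_add_right (mul_le_mul_of_nonneg_left (gridSum_mono (leftConst_phiBar _ _ _)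
      (leftConst_phiBar _ _ _) hM hθ ht fun ω => h.mono _ (M.grid_sub_roundedDemand θ hz t ω) _
        (M.grid_sub_roundedDemand θ hw t ω) (by linarith)) hM.α_pos.le) _

theorem isMonoOnGrid_phiBar (hM : M.StandingAssumptions) (hγ : M.LipschitzCondition γ) (hθ : 0 < θ)
    (n : ℕ) : ∀ t, t + n < M.T → IsMonoOnGrid θ (M.phiBar θ γ n t θ) := by
  induction n with
  | zero =>
    intro t ht
    refine isMonoOnGrid_of_threshold (h := fun _ => γ t * θ) (fun z hz => phiBar_of_lt hz)
      (fun z _ hz => phiBar_zero_of_le hz) ⟨fun _ _ => mul_nonneg (hγ t ht).1 hθ.le,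
        fun _ _ _ _ _ => le_rfl⟩
  | succ n ih =>
    intro t ht
    exact isMonoOnGrid_of_threshold (fun z hz => phiBar_of_lt hz)
      (fun z hz hsz => phiBar_succ_of_le hθ
        (isOptimalOnGrid hM hγ hθ (n := n) (by omega)).s_mem hz hsz)
      ((ih (t + 1) (by omega)).psiBar hM hγ hθ (by omega))

theorem isMonoOnGrid_psiBar (hM : M.StandingAssumptions) (hγ : M.LipschitzCondition γ)
    (hθ : 0 < θ) {n t : ℕ} (ht : t + n + 1 < M.T) : IsMonoOnGrid θ (M.psiBar θ γ (n + 1) t θ) :=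
  (isMonoOnGrid_phiBar hM hγ hθ n (t + 1) (by omega)).psiBar hM hγ hθ (by omega)

/-! ### Variation of the approximate value functions within a cell. -/

/-- The variation of `g` along any three points of the grid cell ending in `z` is at most `B z`. -/
def CellVariationLE (θ : ℝ) (g B : ℝ → ℝ) : Prop :=
  ∀ z ∈ grid θ, ∀ a b c, z - θ ≤ a → a ≤ b → b ≤ c → c ≤ z → |g a - g b| + |g b - g c| ≤ B z

/-- In the last period the reorder point solves C(s) = C(S) + K exactly, so V has no jump and
inherits the Lipschitz constant of C. -/
theorem Vrec_zero_eq (hM : M.StandingAssumptions) (hγ : M.LipschitzCondition γ) {t : ℕ}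
    (ht : t < M.T) (y : ℝ) : M.Vrec θ 0 t y = M.C t (max y (M.srec θ 0 t)) := by
  rcases lt_or_ge y (M.srec θ 0 t) with h | h
  · rw [Vrec_of_lt h, max_eq_right h.le]; exact (Ybar_spec hM hγ ht).2.symm
  · rw [Vrec_of_le h, max_eq_left h]; rfl

theorem abs_Vrec_zero_sub_le (hM : M.StandingAssumptions) (hγ : M.LipschitzCondition γ) {t : ℕ}
    (ht : t < M.T) {a b : ℝ} (hab : a ≤ b) :
    |M.Vrec θ 0 t a - M.Vrec θ 0 t b| ≤ γ t * (b - a) := by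
  rw [Vrec_zero_eq hM hγ ht, Vrec_zero_eq hM hγ ht]
  refine ((hγ t ht).2 _ _).trans (mul_le_mul_of_nonneg_left ?_ (hγ t ht).1)
  refine (abs_max_sub_max_le_abs _ _ _).trans ?_
  rw [abs_sub_comm, abs_of_nonneg (sub_nonneg.2 hab)]

theorem cellVariationLE_Vrec_zero (hM : M.StandingAssumptions) (hγ : M.LipschitzCondition γ) {t : ℕ}
    (ht : t < M.T) : CellVariationLE θ (M.Vrec θ 0 t) (M.phiBar θ γ 0 t θ) := by
  intro z _ a b c ha hab hbc hc
  rcases lt_or_ge z (M.srec θ 0 t) with h | h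
  · rw [phiBar_of_lt h, Vrec_of_lt (by linarith), Vrec_of_lt (by linarith),
      Vrec_of_lt (by linarith)]
    simp
  · rw [phiBar_zero_of_le h]
    have h1 := abs_Vrec_zero_sub_le (θ := θ) hM hγ ht hab
    have h2 := abs_Vrec_zero_sub_le (θ := θ) hM hγ ht hbc
    have h3 := mul_le_mul_of_nonneg_left (show c - a ≤ θ by linarith) (hγ t ht).1
    linarith

/-- The rounded demand is a multiple of θ, so it carries the cell ending in z onto the cell ending
in z - R, and the variations can be averaged over R. -/
theorem CellVariationLE.Hrec {n t : ℕ}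
    (h : CellVariationLE θ (M.Vrec θ n (t + 1)) (M.phiBar θ γ n (t + 1) θ))
    (hM : M.StandingAssumptions) (hγ : M.LipschitzCondition γ) (hθ : 0 < θ) (ht : t < M.T) :
    CellVariationLE θ (M.Hrec θ (n + 1) t) (M.psiBar θ γ (n + 1) t θ) := by
  intro z hz a b c ha hab hbc hc
  have hV := leftConst_Vrec (M := M) (θ := θ) n (t + 1)
  have hφ := leftConst_phiBar (M := M) (θ := θ) (γ := γ) n (t + 1) θ
  have hi := hV.integrable hM hθ ht
  have hiabs : ∀ x y, Integrable (fun ω => |M.Vrec θ n (t + 1) (x - M.roundedDemand θ t ω)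
      - M.Vrec θ n (t + 1) (y - M.roundedDemand θ t ω)|) M.P := fun x y => ((hi x).sub (hi y)).abs
  have habs : ∀ x y, |M.gridSum θ t (M.Vrec θ n (t + 1)) x - M.gridSum θ t (M.Vrec θ n (t + 1)) y| ≤
      ∫ ω, |M.Vrec θ n (t + 1) (x - M.roundedDemand θ t ω)
        - M.Vrec θ n (t + 1) (y - M.roundedDemand θ t ω)| ∂M.P := by
    intro x y
    rw [hV.gridSum_eq hM hθ ht, hV.gridSum_eq hM hθ ht, ← integral_sub (hi x) (hi y)]
    exact abs_integral_le_integral_abs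
  have hC : ∀ x y, x ≤ y → |M.C t x - M.C t y| ≤ γ t * (y - x) := by
    intro x y hxy
    have := (hγ t ht).2 x y
    rwa [abs_sub_comm x y, abs_of_nonneg (sub_nonneg.2 hxy)] at this
  have hH : ∀ x y, x ≤ y → |M.Hrec θ (n + 1) t x - M.Hrec θ (n + 1) t y| ≤ γ t * (y - x) +
      M.α * ∫ ω, |M.Vrec θ n (t + 1) (x - M.roundedDemand θ t ω)
        - M.Vrec θ n (t + 1) (y - M.roundedDemand θ t ω)| ∂M.P := by
    intro x y hxy
    rw [Hrec_succ, Hrec_succ]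
    have h1 := abs_add_le (M.C t x - M.C t y) (M.α * (M.gridSum θ t (M.Vrec θ n (t + 1)) x
      - M.gridSum θ t (M.Vrec θ n (t + 1)) y))
    rw [abs_mul, abs_of_pos hM.α_pos] at h1
    have h2 := mul_le_mul_of_nonneg_left (habs x y) hM.α_pos.le
    rw [show M.C t x + M.α * M.gridSum θ t (M.Vrec θ n (t + 1)) x
      - (M.C t y + M.α * M.gridSum θ t (M.Vrec θ n (t + 1)) y) = M.C t x - M.C t y +
        M.α * (M.gridSum θ t (M.Vrec θ n (t + 1)) x
          - M.gridSum θ t (M.Vrec θ n (t + 1)) y) by ring]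
    linarith [hC x y hxy]
  have hsum : ∫ ω, |M.Vrec θ n (t + 1) (a - M.roundedDemand θ t ω)
        - M.Vrec θ n (t + 1) (b - M.roundedDemand θ t ω)| ∂M.P
      + ∫ ω, |M.Vrec θ n (t + 1) (b - M.roundedDemand θ t ω)
        - M.Vrec θ n (t + 1) (c - M.roundedDemand θ t ω)| ∂M.P
      ≤ M.gridSum θ t (M.phiBar θ γ n (t + 1) θ) z := by
    rw [hφ.gridSum_eq hM hθ ht, ← integral_add (hiabs a b) (hiabs b c)]
    exact integral_mono ((hiabs a b).add (hiabs b c))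
      (hφ.integrable hM hθ ht z) fun ω => h _ (M.grid_sub_roundedDemand θ hz t ω) _ _ _
        (by linarith) (by linarith) (by linarith) (by linarith)
  have h1 := hH a b hab
  have h2 := hH b c hbc
  have h3 := mul_le_mul_of_nonneg_left hsum hM.α_pos.le
  have h4 := mul_le_mul_of_nonneg_left (show c - a ≤ θ by linarith) (hγ t ht).1
  rw [psiBar_succ hM hθ n ht]
  linarith

theorem CellVariationLE.Vrec {n t : ℕ}
    (h : CellVariationLE θ (M.Hrec θ (n + 1) t) (M.psiBar θ γ (n + 1) t θ))
    (hM : M.StandingAssumptions) (hγ : M.LipschitzCondition γ) (hθ : 0 < θ)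
    (ht : t + n + 1 < M.T) :
    CellVariationLE θ (M.Vrec θ (n + 1) t) (M.phiBar θ γ (n + 1) t θ) := by
  intro z hz a b c ha hab hbc hc
  have hopt := isOptimalOnGrid hM hγ hθ ht
  rcases lt_trichotomy z (M.srec θ (n + 1) t) with h1 | h1 | h1
  · rw [phiBar_of_lt h1, Vrec_of_lt (by linarith), Vrec_of_lt (by linarith),
      Vrec_of_lt (by linarith)]
    simp
  · rw [phiBar_succ_of_le hθ hopt.s_mem hz h1.ge]
    have h0 := (isMonoOnGrid_psiBar hM hγ hθ ht).nonneg z hz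
    have h2 := h z hz (z - θ) z z le_rfl (by linarith) le_rfl le_rfl
    rw [sub_self, abs_zero, add_zero] at h2
    -- The jump of V at s is controlled through the grid point s - θ: there H is at least H(S) + K,
    -- so the jump is at most H(s - θ) - H(s).
    have h3 := hopt.le_of_lt _ (grid_sub hz) (by linarith)
    have h4 := hopt.threshold.between z hz h1.ge (h1.trans_le hopt.threshold.le)
    have key : |M.Hrec θ (n + 1) t (M.Srec θ (n + 1) t) + M.K t - M.Hrec θ (n + 1) t z| ≤
        M.psiBar θ γ (n + 1) t θ z := by
      rw [abs_of_nonneg (by linarith)]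
      linarith [le_abs_self (M.Hrec θ (n + 1) t (z - θ) - M.Hrec θ (n + 1) t z)]
    have hval : ∀ y, y ≤ z → y = z ∨ M.Vrec θ (n + 1) t y =
        M.Hrec θ (n + 1) t (M.Srec θ (n + 1) t) + M.K t := fun y hy =>
      hy.eq_or_lt.imp_right fun hlt => Vrec_of_lt (hlt.trans_eq h1)
    have hz' : M.Vrec θ (n + 1) t z = M.Hrec θ (n + 1) t z := Vrec_of_le h1.ge
    rcases hval a (by linarith) with h5 | h5
    · obtain rfl : b = z := by linarith
      obtain rfl : c = b := by linarith
      rw [h5]; simpa using h0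
    · rcases hval b (by linarith) with h6 | h6
      · obtain rfl : c = z := by linarith
        rw [h5, h6, hz']
        simpa using key
      · rw [h5, h6, sub_self, abs_zero, zero_add]
        rcases hval c hc with h7 | h7
        · rw [h7, hz']; exact key
        · rw [h7]; simpa using h0
  · have h2 := grid_le_sub hθ hopt.s_mem hz h1
    rw [phiBar_succ_of_le hθ hopt.s_mem hz h1.le, Vrec_of_le (by linarith),
      Vrec_of_le (by linarith), Vrec_of_le (by linarith)]
    exact h z hz a b c ha hab hbc hc

theorem cellVariationLE_Vrec (hM : M.StandingAssumptions) (hγ : M.LipschitzCondition γ)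
    (hθ : 0 < θ) (n : ℕ) : ∀ t, t + n < M.T →
      CellVariationLE θ (M.Vrec θ n t) (M.phiBar θ γ n t θ) := by
  induction n with
  | zero => exact fun t ht => cellVariationLE_Vrec_zero hM hγ ht
  | succ n ih =>
    exact fun t ht => ((ih (t + 1) (by omega)).Hrec hM hγ hθ (by omega)).Vrec hM hγ hθ (by omega)

theorem cellVariationLE_Hrec (hM : M.StandingAssumptions) (hγ : M.LipschitzCondition γ)
    (hθ : 0 < θ) {n t : ℕ} (ht : t + n + 1 < M.T) :
    CellVariationLE θ (M.Hrec θ (n + 1) t) (M.psiBar θ γ (n + 1) t θ) :=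
  (cellVariationLE_Vrec hM hγ hθ n (t + 1) (by omega)).Hrec hM hγ hθ (by omega)

/-! ### Monotonicity of `ω` -/

variable (M θ γ) in
/-- `ω̄_t`, with the two indices of the recursion. -/
noncomputable def omegaBarRec (n t : ℕ) : ℝ → ℝ := M.omegaBarOf θ γ n t (M.omegaRec θ γ n t)

theorem omegaRec_succ (n t : ℕ) (x : ℝ) : M.omegaRec θ γ (n + 1) t x =
    M.psi θ γ (n + 1) t θ x - γ t * θ + M.α * M.gridSum θ t (M.omegaBarRec θ γ n (t + 1)) x := rfl

variable (M θ γ) in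
/-- `η_t`. -/
noncomputable def eta (n t : ℕ) : ℝ :=
  M.psiBar θ γ (n + 1) t θ (M.SU θ t) + M.omegaRec θ γ (n + 1) t (M.SU θ t)

theorem omegaBarRec_of_le {n t : ℕ} {x : ℝ} (h : x ≤ M.SU θ t) :
    M.omegaBarRec θ γ (n + 1) t x = M.eta θ γ n t := if_pos h

theorem omegaBarRec_of_lt {n t : ℕ} {x : ℝ} (h : M.SU θ t < x) :
    M.omegaBarRec θ γ (n + 1) t x = max (M.eta θ γ n t) (M.omegaRec θ γ (n + 1) t x) :=
  if_neg h.not_ge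

theorem eta_le_omegaBarRec (n t : ℕ) (x : ℝ) :
    M.eta θ γ n t ≤ M.omegaBarRec θ γ (n + 1) t x := by
  rcases le_or_gt x (M.SU θ t) with h | h
  · rw [omegaBarRec_of_le h]
  · rw [omegaBarRec_of_lt h]; exact le_max_left _ _

theorem leftConst_omegaBarRec (n t : ℕ) : LeftConst (M.omegaBarRec θ γ n t) := by
  cases n with
  | zero => exact ⟨0, 0, fun _ _ => rfl⟩
  | succ n => exact ⟨M.SU θ t, M.eta θ γ n t, fun y hy => omegaBarRec_of_le hy.le⟩

theorem omegaRec_mono (hM : M.StandingAssumptions) (hγ : M.LipschitzCondition γ) (hθ : 0 < θ)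
    {n t : ℕ} (ht : t + n + 1 < M.T) (h : Monotone (M.omegaBarRec θ γ n (t + 1))) :
    Monotone (M.omegaRec θ γ (n + 1) t) := by
  intro x y hxy
  have h1 := ((isMonoBound_phi hM hγ hθ n (t + 1) (by omega)).psi hM hγ hθ
    (by omega)).mono θ θ x y hθ.le le_rfl hxy
  have h2 := mul_le_mul_of_nonneg_left (gridSum_mono (leftConst_omegaBarRec _ _)
    (leftConst_omegaBarRec _ _) hM hθ (show t < M.T by omega) (y₁ := x) (y₂ := y)
    fun ω => h (by linarith)) hM.α_pos.le
  rw [omegaRec_succ, omegaRec_succ]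
  linarith

theorem omegaBarRec_mono (hM : M.StandingAssumptions) (hγ : M.LipschitzCondition γ) (hθ : 0 < θ)
    (n : ℕ) : ∀ t, t + n < M.T → Monotone (M.omegaBarRec θ γ n t) := by
  induction n with
  | zero => exact fun t _ x y _ => le_rfl
  | succ n ih =>
    intro t ht x y hxy
    rcases le_or_gt x (M.SU θ t) with h | h
    · rw [omegaBarRec_of_le h]; exact eta_le_omegaBarRec _ _ _
    · rw [omegaBarRec_of_lt h, omegaBarRec_of_lt (h.trans_le hxy)]
      exact max_le_max le_rfl (omegaRec_mono hM hγ hθ (by omega) (ih (t + 1) (by omega)) hxy)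

end InventorySystem

namespace InventorySystem

variable {Ω : Type*} [MeasurableSpace Ω] {M : InventorySystem Ω} {θ : ℝ} {γ : ℕ → ℝ}

/-! ### The exact value is bounded below -/

theorem optValue_le_add (hM : M.StandingAssumptions) (hγ : M.LipschitzCondition γ) {n t : ℕ}
    (h : t + n + 1 = M.T) {a b : ℝ} (hab : a ≤ b) :
    M.optValue (n + 1) t a ≤ M.K t + M.optValue (n + 1) t b :=
  (isCostToGo_costToGo hM hγ h).orderValue_le_add (hM.K_nonneg t (by omega)) hab

/-- A lower level costs at most one extra setup in the next period, and α K_{t+1} ≤ K_t. -/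
theorem costToGo_le_add (hM : M.StandingAssumptions) (hγ : M.LipschitzCondition γ) {n t : ℕ}
    (h : t + n + 2 = M.T) {a b : ℝ} (hab : a ≤ b) :
    M.costToGo (n + 1) t a ≤ M.costToGo (n + 1) t b + (M.C t a - M.C t b) + M.K t := by
  have := hM.isProb
  have ht : t < M.T := by omega
  have hu := isLip_optValue hM hγ (show t + 1 + (n + 1) = M.T by omega)
  have hi := integrable_comp_sub_demand hu hM ht
  have h1 : ∫ ω, M.optValue (n + 1) (t + 1) (a - M.D t ω) ∂M.P ≤
      ∫ ω, (M.K (t + 1) + M.optValue (n + 1) (t + 1) (b - M.D t ω)) ∂M.P :=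
    integral_mono (hi a) ((integrable_const _).add (hi b)) fun ω =>
      optValue_le_add hM hγ (by omega) (by linarith)
  rw [integral_add (integrable_const _) (hi b), integral_const, probReal_univ, one_smul] at h1
  have h2 := mul_le_mul_of_nonneg_left h1 hM.α_pos.le
  have h3 := hM.K_decr t (by omega)
  unfold costToGo
  linarith

/-- The last period is solved exactly: H and J both equal C, so the (s, S) rule can be compared with
the minimizer directly. -/
theorem Vrec_zero_le_optValue (hM : M.StandingAssumptions) (hγ : M.LipschitzCondition γ) {t : ℕ}
    (ht : t + 1 = M.T) (x : ℝ) : M.Vrec θ 0 t x ≤ M.optValue 1 t x := by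
  have ht' : t < M.T := by omega
  obtain ⟨y, hxy, he⟩ := (isCostToGo_costToGo hM hγ (n := 0) (t := t) ht).exists_orderValue_eq
    (hM.K_nonneg t ht') x
  rw [optValue_succ, he, costToGo_zero]
  have hthr := isThreshold_zero (θ := θ) hM hγ ht'
  rcases hxy.eq_or_lt with rfl | h1
  · rw [sub_self, if_neg (lt_irrefl 0), mul_zero, zero_add, Vrec_zero_eq hM hγ ht']
    rcases le_total x (M.srec θ 0 t) with h2 | h2
    · rw [max_eq_right h2]
      exact C_le_of_le_Cm hM hγ ht' h2 hthr.le
    · rw [max_eq_left h2]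
  · rw [if_pos (sub_pos.2 h1), mul_one]
    rcases lt_or_ge x (M.srec θ 0 t) with h2 | h2
    · rw [Vrec_of_lt h2, add_comm]
      exact add_le_add_right (hthr.isMin y trivial) _
    · rw [Vrec_of_le h2]
      exact hthr.le_add trivial trivial h2 hxy

/-- Pass from V(y - R) to V(y - D) at the cost φ(θ, z - R), and from there to the exact value by
induction. Averaging yields the two terms of ω, since ψ(θ, z) - γ θ is the discounted mean of φ(θ, z
- R). -/
theorem Hrec_le_costToGo_add (hM : M.StandingAssumptions) (hγ : M.LipschitzCondition γ)
    (hθ : 0 < θ) {n t : ℕ} (h : t + n + 2 = M.T)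
    (ih : ∀ z ∈ grid θ, ∀ x, z - θ < x → x ≤ z → M.Vrec θ n (t + 1) x ≤
      M.optValue (n + 1) (t + 1) x + M.omegaBarRec θ γ n (t + 1) z) {z y : ℝ} (hz : z ∈ grid θ)
    (hzy : z - θ < y) (hyz : y ≤ z) :
    M.Hrec θ (n + 1) t y ≤ M.costToGo (n + 1) t y + M.omegaRec θ γ (n + 1) t z := by
  have ht : t < M.T := by omega
  have hV := leftConst_Vrec (M := M) (θ := θ) n (t + 1)
  have hφ := leftConst_phi (M := M) (θ := θ) (γ := γ) n (t + 1) θ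
  have hω := leftConst_omegaBarRec (M := M) (θ := θ) (γ := γ) n (t + 1)
  have hu := isLip_optValue hM hγ (show t + 1 + (n + 1) = M.T by omega)
  have hi := integrable_comp_sub_demand hu hM ht y
  have hi' : Integrable (fun ω => M.phi θ γ n (t + 1) θ (z - M.roundedDemand θ t ω)
      + M.omegaBarRec θ γ n (t + 1) (z - M.roundedDemand θ t ω)) M.P :=
    (hφ.integrable hM hθ ht z).add (hω.integrable hM hθ ht z)
  have h1 : M.gridSum θ t (M.Vrec θ n (t + 1)) y ≤
      ∫ ω, (M.optValue (n + 1) (t + 1) (y - M.D t ω)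
        + (M.phi θ γ n (t + 1) θ (z - M.roundedDemand θ t ω)
          + M.omegaBarRec θ γ n (t + 1) (z - M.roundedDemand θ t ω))) ∂M.P := by
    rw [hV.gridSum_eq hM hθ ht]
    refine integral_mono_ae (hV.integrable hM hθ ht y) (hi.add hi') ?_
    filter_upwards [hM.D_nonneg t ht] with ω hω
    have h2 := roundedDemand_lt (M := M) hθ hω
    have h3 := le_roundedDemand_add (M := M) hθ t ω
    have hw := M.grid_sub_roundedDemand θ hz t ω
    have h4 := Vrec_sub_le_phi hM hγ hθ n (t + 1) (by omega) θ (y - M.D t ω)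
      (y - M.roundedDemand θ t ω) (by linarith) (by linarith)
    have h5 := (isMonoBound_phi hM hγ hθ n (t + 1) (by omega)).mono θ θ
      (y - M.roundedDemand θ t ω) (z - M.roundedDemand θ t ω) hθ.le le_rfl (by linarith)
    have h6 : M.Vrec θ n (t + 1) (y - M.D t ω) ≤ M.optValue (n + 1) (t + 1) (y - M.D t ω)
        + M.omegaBarRec θ γ n (t + 1) (z - M.roundedDemand θ t ω) := by
      -- The level y - D lies in the cell ending in z - R or in the preceding one; monotonicity of
      -- ω̄ covers the latter.
      rcases lt_or_ge (z - M.roundedDemand θ t ω - θ) (y - M.D t ω) with h7 | h7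
      · exact ih _ hw _ h7 (by linarith)
      · have h8 := ih _ (grid_sub hw) _ (by linarith) h7
        have h9 := omegaBarRec_mono hM hγ hθ n (t + 1) (by omega)
          (show z - M.roundedDemand θ t ω - θ ≤ z - M.roundedDemand θ t ω by linarith)
        linarith
    linarith
  rw [integral_add hi hi', integral_add (hφ.integrable hM hθ ht z) (hω.integrable hM hθ ht z),
    ← hφ.gridSum_eq hM hθ ht, ← hω.gridSum_eq hM hθ ht] at h1
  have h2 := mul_le_mul_of_nonneg_left h1 hM.α_pos.le
  rw [Hrec_succ, costToGo, omegaRec_succ, psi_succ hM hθ n ht]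
  linarith

theorem omegaRec_le_omegaBarRec (hM : M.StandingAssumptions) (hγ : M.LipschitzCondition γ)
    (hθ : 0 < θ) {n t : ℕ} (ht : t + n + 1 < M.T) (x : ℝ) :
    M.omegaRec θ γ (n + 1) t x ≤ M.omegaBarRec θ γ (n + 1) t x := by
  rcases le_or_gt x (M.SU θ t) with h | h
  · rw [omegaBarRec_of_le h, eta]
    have h1 := omegaRec_mono hM hγ hθ ht (omegaBarRec_mono hM hγ hθ n (t + 1) (by omega)) h
    have h2 := (isMonoOnGrid_psiBar hM hγ hθ ht).nonneg _ (SU_spec hM hθ (t := t) (by omega)).1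
    linarith
  · rw [omegaBarRec_of_lt h]; exact le_max_right _ _

/-- Given H ≤ J + ω, the (s, S) rule is compared with an exact decision y from x. Targets beyond S^U
are replaced by the last grid point before C^m or by not ordering; targets up to S^U cost at most η.
-/
theorem Vrec_le_optValue_add_succ (hM : M.StandingAssumptions) (hγ : M.LipschitzCondition γ)
    (hθ : 0 < θ) {n t : ℕ} (h : t + n + 2 = M.T)
    (ih : ∀ z ∈ grid θ, ∀ x, z - θ < x → x ≤ z → M.Vrec θ n (t + 1) x ≤
      M.optValue (n + 1) (t + 1) x + M.omegaBarRec θ γ n (t + 1) z) {z x : ℝ} (hz : z ∈ grid θ)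
    (hzx : z - θ < x) (hxz : x ≤ z) : M.Vrec θ (n + 1) t x ≤
      M.optValue (n + 2) t x + M.omegaBarRec θ γ (n + 1) t z := by
  have ht : t < M.T := by omega
  have ht1 : t + n + 1 < M.T := by omega
  have hK := hM.K_nonneg t ht
  have hopt := isOptimalOnGrid hM hγ hθ ht1
  have hvar := cellVariationLE_Hrec hM hγ hθ ht1
  have hψ := isMonoOnGrid_psiBar hM hγ hθ ht1
  have hωm := omegaRec_mono hM hγ hθ ht1 (omegaBarRec_mono hM hγ hθ n (t + 1) (by omega))
  have hHJ : ∀ z ∈ grid θ, ∀ y, z - θ < y → y ≤ z → M.Hrec θ (n + 1) t y ≤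
      M.costToGo (n + 1) t y + M.omegaRec θ γ (n + 1) t z :=
    fun z hz y h1 h2 => Hrec_le_costToGo_add hM hγ hθ h ih hz h1 h2
  obtain ⟨hUg, hCU, hUC⟩ := SU_spec hM hθ ht
  have hpreU : M.preMin θ t ≤ M.SU θ t := (preMin_lt hθ t).le.trans hCU
  have hcell : ∀ y ≤ M.SU θ t, ∃ w ∈ grid θ, w - θ < y ∧ y ≤ w ∧ w ≤ M.SU θ t := by
    intro y hy
    obtain ⟨w, hw, h1, h2⟩ := exists_grid_cell hθ y
    refine ⟨w, hw, h1, h2, not_lt.1 fun h3 => ?_⟩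
    linarith [grid_le_sub hθ hUg hw h3]
  have hη : M.eta θ γ n t = M.psiBar θ γ (n + 1) t θ (M.SU θ t)
    + M.omegaRec θ γ (n + 1) t (M.SU θ t) := rfl
  -- C at y exceeds C at the grid point before C^m by more than K, and the future cannot repay more
  -- than K.
  have hJpre : ∀ y, M.SU θ t < y →
      M.costToGo (n + 1) t (M.preMin θ t) ≤ M.costToGo (n + 1) t y := by
    intro y hy
    have h1 := costToGo_le_add hM hγ h (hpreU.trans hy.le)
    have h2 := C_le_of_Cm_le hM hγ ht hCU hy.le
    linarith
  have hS : ∀ y, M.Hrec θ (n + 1) t (M.Srec θ (n + 1) t) ≤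
      M.costToGo (n + 1) t y + M.eta θ γ n t := by
    have key : ∀ y ≤ M.SU θ t, M.Hrec θ (n + 1) t (M.Srec θ (n + 1) t) ≤
        M.costToGo (n + 1) t y + M.eta θ γ n t := by
      intro y hy
      obtain ⟨w, hw, h1, h2, h3⟩ := hcell y hy
      have h4 := hopt.threshold.isMin _ (grid_sub hw)
      have h5 := hvar w hw (w - θ) y y le_rfl h1.le le_rfl h2
      rw [sub_self, abs_zero, add_zero] at h5
      have h6 := le_of_abs_le h5
      have h7 := hψ.mono w hw _ hUg h3
      have h8 := hHJ w hw y h1 h2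
      have h9 := hωm h3
      linarith
    intro y
    rcases le_or_gt y (M.SU θ t) with h1 | h1
    · exact key y h1
    · exact (key _ hpreU).trans (by linarith [hJpre y h1])
  have hmid : M.srec θ (n + 1) t ≤ x → ∀ y, x < y → y ≤ M.SU θ t → M.Hrec θ (n + 1) t x ≤
      M.K t + M.costToGo (n + 1) t y + M.eta θ γ n t := by
    intro hsx y hxy hyU
    obtain ⟨w, hw, h1, h2, h3⟩ := hcell y hyU
    have hzw : z ≤ w := by
      by_contra hcon
      linarith [grid_le_sub hθ hw hz (not_le.1 hcon)]
    have hψw := hψ.mono w hw _ hUg h3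
    have hψz := hψ.mono z hz _ hUg (hzw.trans h3)
    have hψ0 := hψ.nonneg z hz
    -- Averaging over both ends of a cell is the reason for the three-point form of the variation:
    -- each of x and y loses ψ̄ / 2, so a single ψ̄ suffices, as η requires.
    have hHy : M.Hrec θ (n + 1) t (w - θ) + M.Hrec θ (n + 1) t w
        ≤ 2 * M.Hrec θ (n + 1) t y + M.psiBar θ γ (n + 1) t θ (M.SU θ t) := by
      have h5 := hvar w hw (w - θ) y w le_rfl h1.le h2 le_rfl
      have h6 := le_abs_self (M.Hrec θ (n + 1) t (w - θ) - M.Hrec θ (n + 1) t y)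
      have h7 := neg_abs_le (M.Hrec θ (n + 1) t y - M.Hrec θ (n + 1) t w)
      linarith
    have hHx : 2 * M.Hrec θ (n + 1) t x ≤ 2 * M.K t + M.Hrec θ (n + 1) t (w - θ)
        + M.Hrec θ (n + 1) t w + M.psiBar θ γ (n + 1) t θ (M.SU θ t) := by
      rcases lt_or_ge (z - θ) (M.srec θ (n + 1) t) with h4 | h4
      · have h5 : z ≤ M.srec θ (n + 1) t := by
          by_contra hcon
          linarith [grid_le_sub hθ hopt.s_mem hz (not_le.1 hcon)]
        -- The only cell without its left end above s that still contains x ≥ s has x = z = s.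
        obtain rfl : x = z := by linarith
        have h6 := hopt.threshold.between x hz hsx (h5.trans hopt.threshold.le)
        have h7 := hopt.threshold.isMin _ (grid_sub hw)
        have h8 := hopt.threshold.isMin _ hw
        linarith
      · have h5 := hvar z hz (z - θ) x z le_rfl hzx.le hxz le_rfl
        have h6 := neg_abs_le (M.Hrec θ (n + 1) t (z - θ) - M.Hrec θ (n + 1) t x)
        have h7 := le_abs_self (M.Hrec θ (n + 1) t x - M.Hrec θ (n + 1) t z)
        have h8 := hopt.threshold.le_add (grid_sub hz) (grid_sub hw) h4 (by linarith)
        have h9 := hopt.threshold.le_add hz hw (by linarith) hzw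
        linarith
    have h8 := hHJ w hw y h1 h2
    have h9 := hωm h3
    linarith
  have hωle := omegaRec_le_omegaBarRec hM hγ hθ ht1 z
  have hηle := eta_le_omegaBarRec (M := M) (θ := θ) (γ := γ) n t z
  obtain ⟨y, hxy, he⟩ := (isCostToGo_costToGo hM hγ (n := n + 1) (t := t)
    (by omega)).exists_orderValue_eq hK x
  rw [optValue_succ, he]
  rcases lt_or_ge x (M.srec θ (n + 1) t) with hxs | hsx
  · rw [Vrec_of_lt hxs]
    rcases hxy.eq_or_lt with rfl | h1
    · rw [sub_self, if_neg (lt_irrefl 0), mul_zero, zero_add]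
      have h2 := hopt.le_of_lt _ (grid_sub hz) (hzx.trans hxs)
      have h3 : z ≤ M.SU θ t := by
        have : z ≤ M.srec θ (n + 1) t := by
          by_contra hcon
          linarith [grid_le_sub hθ hopt.s_mem hz (not_le.1 hcon)]
        exact this.trans (hopt.threshold.le.trans hopt.S_le)
      have h5 := hvar z hz (z - θ) x x le_rfl hzx.le le_rfl hxz
      rw [sub_self, abs_zero, add_zero] at h5
      have h6 := le_of_abs_le h5
      have h7 := hψ.mono z hz _ hUg h3
      have h8 := hHJ z hz x hzx hxz
      have h9 := hωm h3
      linarith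
    · rw [if_pos (sub_pos.2 h1), mul_one]
      linarith [hS y]
  · rw [Vrec_of_le hsx]
    have hHx := hHJ z hz x hzx hxz
    rcases hxy.eq_or_lt with rfl | h1
    · rw [sub_self, if_neg (lt_irrefl 0), mul_zero, zero_add]
      linarith
    · rw [if_pos (sub_pos.2 h1), mul_one]
      rcases le_or_gt y (M.SU θ t) with h2 | h2
      · linarith [hmid hsx y h1 h2]
      -- If x lies below the grid point before C^m, ordering to that point beats y. Otherwise C x ≤
      -- C y, and not ordering loses at most K against J y.
      rcases lt_or_ge x (M.preMin θ t) with h3 | h3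
      · linarith [hmid hsx _ h3 hpreU, hJpre y h2]
      · have h4 := costToGo_le_add hM hγ h hxy
        have h5 : M.C t x ≤ M.C t y := by
          rcases le_total (M.Cm t) x with h6 | h6
          · exact C_le_of_Cm_le hM hγ ht h6 hxy
          · linarith [C_le_of_le_Cm hM hγ ht h3 h6, C_le_of_Cm_le hM hγ ht hCU h2.le]
        linarith

theorem Vrec_le_optValue_add (hM : M.StandingAssumptions) (hγ : M.LipschitzCondition γ)
    (hθ : 0 < θ) (n : ℕ) : ∀ t, t + n + 1 = M.T → ∀ z ∈ grid θ, ∀ x, z - θ < x → x ≤ z →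
      M.Vrec θ n t x ≤ M.optValue (n + 1) t x + M.omegaBarRec θ γ n t z := by
  induction n with
  | zero =>
    intro t ht z _ x _ _
    have h : M.omegaBarRec θ γ 0 t z = 0 := rfl
    rw [h, add_zero]
    exact Vrec_zero_le_optValue hM hγ ht x
  | succ n ih =>
    intro t ht z hz x h1 h2
    exact Vrec_le_optValue_add_succ hM hγ hθ (by omega) (ih (t + 1) (by omega)) hz h1 h2

end InventorySystem

namespace InventorySystem

variable {Ω : Type*} [MeasurableSpace Ω] {M : InventorySystem Ω} {θ : ℝ} {γ : ℕ → ℝ}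

/-! ### The exact value is bounded above -/

/-- λ extends at its far end, whereas the induction on periods needs its first step split off. -/
theorem lam_succ_eq (t : ℕ) (z : ℝ) (i : ℕ) : M.lam θ t z (i + 1) =
    M.lam θ (t + 1) (max z (M.Srec θ (M.T - 1 - t) t) + θ) i := by
  induction i with
  | zero => rfl
  | succ i ih =>
    rw [lam, ih, lam, show t + (i + 1) = t + 1 + i by omega]

theorem epsBar_of_add_two_eq {t : ℕ} (h : t + 2 = M.T) (z : ℝ) :
    M.epsBar θ γ t z = M.α * γ (t + 1) * θ := by
  rw [epsBar, ← h, show t + 2 - 1 - t = 1 by omega, show t + 2 - 2 - t = 0 by omega,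
    show t + 2 - 1 = t + 1 by omega]
  simp

theorem epsBar_of_add_three_eq {t n : ℕ} (h : t + n + 3 = M.T) (z : ℝ) :
    M.epsBar θ γ t z = 2 * (M.psiBar θ γ (n + 2) t θ (max z (M.Srec θ (n + 2) t)) - γ t * θ)
      + M.α * M.epsBar θ γ (t + 1) (max z (M.Srec θ (n + 2) t) + θ) := by
  have h1 : M.T - 1 - t = n + 2 := by omega
  rw [epsBar, epsBar, show M.T - 2 - t = n + 1 by omega, show M.T - 2 - (t + 1) = n by omega, h1,
    show M.T - 1 - (t + 1) = n + 1 by omega, Finset.sum_range_succ', mul_add, Finset.mul_sum]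
  have h2 : ∀ i ∈ Finset.range n, 2 * M.α ^ (i + 1) *
      (M.psiBar θ γ (M.T - 1 - (t + (i + 1))) (t + (i + 1)) θ
          (max (M.lam θ t z (i + 1)) (M.Srec θ (M.T - 1 - (t + (i + 1))) (t + (i + 1))))
        - γ (t + (i + 1)) * θ) = M.α * (2 * M.α ^ i *
      (M.psiBar θ γ (M.T - 1 - (t + 1 + i)) (t + 1 + i) θ
          (max (M.lam θ (t + 1) (max z (M.Srec θ (n + 2) t) + θ) i)
            (M.Srec θ (M.T - 1 - (t + 1 + i)) (t + 1 + i)))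
        - γ (t + 1 + i) * θ)) := by
    intro i _
    rw [lam_succ_eq, h1, show t + (i + 1) = t + 1 + i by omega]
    ring
  rw [Finset.sum_congr rfl h2]
  simp only [add_zero, pow_zero, lam, h1]
  ring

theorem optValue_one_le_Vrec_zero (hM : M.StandingAssumptions) (hγ : M.LipschitzCondition γ)
    {t : ℕ} (ht : t + 1 = M.T) (x : ℝ) : M.optValue 1 t x ≤ M.Vrec θ 0 t x := by
  have ht' : t < M.T := by omega
  have hK := hM.K_nonneg t ht'
  rw [optValue_succ]
  rcases lt_or_ge x (M.srec θ 0 t) with h | h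
  · have h1 := (isCostToGo_costToGo hM hγ (n := 0) (t := t) ht).orderValue_le (K := M.K t)
      (h.le.trans (isThreshold_zero hM hγ ht').le)
    have h2 : M.K t * (if 0 < M.Srec θ 0 t - x then 1 else 0) ≤ M.K t := by
      split_ifs <;> linarith
    rw [costToGo_zero] at h1 ⊢
    rw [Vrec_of_lt h, add_comm]
    exact h1.trans (add_le_add_left h2 _)
  · rw [Vrec_of_le h, costToGo_zero]
    exact min_le_left _ _

/-- The approximate rule is a feasible decision in the exact problem: stay at x, or order to S if x
< s. The estimate J ≤ H + E is thus needed only up to the larger of z and S. -/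
theorem optValue_le_Vrec_add_of_costToGo (hM : M.StandingAssumptions)
    (hγ : M.LipschitzCondition γ) (hθ : 0 < θ) {n t : ℕ} (h : t + n + 2 = M.T) {z E : ℝ}
    (hE : ∀ y ≤ max z (M.Srec θ (n + 1) t),
      M.costToGo (n + 1) t y ≤ M.Hrec θ (n + 1) t y + E) {x : ℝ} (hx : x ≤ z) :
    M.optValue (n + 2) t x ≤ M.Vrec θ (n + 1) t x + E := by
  have ht' : t < M.T := by omega
  have hK := hM.K_nonneg t ht'
  have hopt := isOptimalOnGrid hM hγ hθ (n := n) (t := t) (by omega)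
  rw [optValue_succ]
  rcases lt_or_ge x (M.srec θ (n + 1) t) with h1 | h1
  · have h2 := (isCostToGo_costToGo hM hγ (n := n + 1) (t := t) (by omega)).orderValue_le
      (K := M.K t) (h1.le.trans hopt.threshold.le)
    have h3 : M.K t * (if 0 < M.Srec θ (n + 1) t - x then 1 else 0) ≤ M.K t := by
      split_ifs <;> linarith
    rw [Vrec_of_lt h1]
    linarith [hE _ (le_max_right z _)]
  · rw [Vrec_of_le h1]
    exact (min_le_left _ _).trans (hE x (hx.trans (le_max_left _ _)))

/-- The last V is Lipschitz on the whole line, so rounding costs γ θ once, without the doubling for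
adjacent cells. -/
theorem costToGo_one_le (hM : M.StandingAssumptions) (hγ : M.LipschitzCondition γ)
    (hθ : 0 < θ) {t : ℕ} (h : t + 2 = M.T) (y : ℝ) :
    M.costToGo 1 t y ≤ M.Hrec θ 1 t y + M.α * γ (t + 1) * θ := by
  have := hM.isProb
  have ht : t < M.T := by omega
  have hV := leftConst_Vrec (M := M) (θ := θ) 0 (t + 1)
  have hi := integrable_comp_sub_demand (isLip_optValue hM hγ (show t + 1 + 1 = M.T by omega)) hM
    ht y
  have h1 : ∫ ω, M.optValue 1 (t + 1) (y - M.D t ω) ∂M.P ≤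
      ∫ ω, (M.Vrec θ 0 (t + 1) (y - M.roundedDemand θ t ω) + γ (t + 1) * θ) ∂M.P := by
    refine integral_mono_ae hi ((hV.integrable hM hθ ht y).add (integrable_const _)) ?_
    filter_upwards [hM.D_nonneg t ht] with ω hω
    have h2 := roundedDemand_lt (M := M) hθ hω
    have h3 := le_roundedDemand_add (M := M) hθ t ω
    have h4 := optValue_one_le_Vrec_zero (θ := θ) hM hγ (t := t + 1) (by omega) (y - M.D t ω)
    have h5 := le_of_abs_le (abs_Vrec_zero_sub_le (θ := θ) hM hγ (t := t + 1) (by omega)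
      (show y - M.D t ω ≤ y - M.roundedDemand θ t ω by linarith))
    have h6 := mul_le_mul_of_nonneg_left
      (show y - M.roundedDemand θ t ω - (y - M.D t ω) ≤ θ by linarith) (hγ (t + 1) (by omega)).1
    linarith
  rw [integral_add (hV.integrable hM hθ ht y) (integrable_const _), integral_const, probReal_univ,
    one_smul, ← hV.gridSum_eq hM hθ ht] at h1
  have h2 := mul_le_mul_of_nonneg_left h1 hM.α_pos.le
  rw [costToGo, Hrec_succ]
  linarith

theorem costToGo_succ_le (hM : M.StandingAssumptions) (hγ : M.LipschitzCondition γ)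
    (hθ : 0 < θ) {n t : ℕ} (h : t + n + 2 = M.T) {w e : ℝ} (hw : w ∈ grid θ)
    (ih : ∀ x ≤ w + θ, M.optValue (n + 1) (t + 1) x ≤ M.Vrec θ n (t + 1) x + e) {y : ℝ}
    (hy : y ≤ w) : M.costToGo (n + 1) t y ≤ M.Hrec θ (n + 1) t y
      + (2 * (M.psiBar θ γ (n + 1) t θ w - γ t * θ) + M.α * e) := by
  have := hM.isProb
  have ht : t < M.T := by omega
  have hV := leftConst_Vrec (M := M) (θ := θ) n (t + 1)
  have hφ := leftConst_phiBar (M := M) (θ := θ) (γ := γ) n (t + 1) θ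
  have hmono := isMonoOnGrid_phiBar hM hγ hθ n (t + 1) (by omega)
  have hvar := cellVariationLE_Vrec hM hγ hθ n (t + 1) (by omega)
  obtain ⟨z, hz, hzy, hyz⟩ := exists_grid_cell hθ y
  have hzw : z ≤ w := by
    by_contra hcon
    linarith [grid_le_sub hθ hw hz (not_le.1 hcon)]
  have hi := integrable_comp_sub_demand
    (isLip_optValue hM hγ (show t + 1 + (n + 1) = M.T by omega)) hM ht y
  have hi' : Integrable (fun ω => 2 * M.phiBar θ γ n (t + 1) θ (w - M.roundedDemand θ t ω) + e)
      M.P := ((hφ.integrable hM hθ ht w).const_mul 2).add (integrable_const e)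
  have h1 : ∫ ω, M.optValue (n + 1) (t + 1) (y - M.D t ω) ∂M.P ≤
      ∫ ω, (M.Vrec θ n (t + 1) (y - M.roundedDemand θ t ω)
        + (2 * M.phiBar θ γ n (t + 1) θ (w - M.roundedDemand θ t ω) + e)) ∂M.P := by
    refine integral_mono_ae hi ((hV.integrable hM hθ ht y).add hi') ?_
    filter_upwards [hM.D_nonneg t ht] with ω hω
    have h2 := roundedDemand_lt (M := M) hθ hω
    have h3 := le_roundedDemand_add (M := M) hθ t ω
    have h4 := ih (y - M.D t ω) (by linarith)
    have hzg := M.grid_sub_roundedDemand θ hz t ω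
    have hwg := M.grid_sub_roundedDemand θ hw t ω
    have h5 := hmono.mono _ hzg _ hwg (by linarith)
    have h6 := hmono.mono _ (grid_sub hzg) _ hzg (by linarith)
    have h7 := hmono.nonneg _ hzg
    -- If y - D and y - R share a cell, one variation suffices; otherwise the path goes through
    -- their common grid point and pays for two cells.
    rcases le_or_gt (z - M.roundedDemand θ t ω - θ) (y - M.D t ω) with h8 | h8
    · have h9 := hvar _ hzg (y - M.D t ω) (y - M.roundedDemand θ t ω)
        (y - M.roundedDemand θ t ω) h8 (by linarith) le_rfl (by linarith)
      rw [sub_self, abs_zero, add_zero] at h9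
      linarith [le_of_abs_le h9]
    · have h9 := hvar _ hzg (z - M.roundedDemand θ t ω - θ) (y - M.roundedDemand θ t ω)
        (y - M.roundedDemand θ t ω) le_rfl (by linarith) le_rfl (by linarith)
      have h10 := hvar _ (grid_sub hzg) (y - M.D t ω) (z - M.roundedDemand θ t ω - θ)
        (z - M.roundedDemand θ t ω - θ) (by linarith) h8.le le_rfl le_rfl
      rw [sub_self, abs_zero, add_zero] at h9 h10
      linarith [le_of_abs_le h9, le_of_abs_le h10]
  rw [integral_add (hV.integrable hM hθ ht y) hi',
    integral_add ((hφ.integrable hM hθ ht w).const_mul 2) (integrable_const e), integral_const,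
    probReal_univ, one_smul, integral_const_mul, ← hV.gridSum_eq hM hθ ht,
    ← hφ.gridSum_eq hM hθ ht] at h1
  have h2 := mul_le_mul_of_nonneg_left h1 hM.α_pos.le
  rw [costToGo, Hrec_succ, psiBar_succ hM hθ n ht]
  linarith

theorem optValue_le_Vrec_add (hM : M.StandingAssumptions) (hγ : M.LipschitzCondition γ)
    (hθ : 0 < θ) (n : ℕ) : ∀ t, t + n + 2 = M.T → ∀ z ∈ grid θ, ∀ x ≤ z,
      M.optValue (n + 2) t x ≤ M.Vrec θ (n + 1) t x + M.epsBar θ γ t z := by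
  induction n with
  | zero =>
    intro t ht z _ x hx
    rw [epsBar_of_add_two_eq (by omega)]
    exact optValue_le_Vrec_add_of_costToGo (n := 0) hM hγ hθ (by omega)
      (fun y _ => costToGo_one_le hM hγ hθ (by omega) y) hx
  | succ n ih =>
    intro t ht z hz x hx
    have hw := grid_max hz (isOptimalOnGrid hM hγ hθ (n := n + 1) (t := t)
      (by omega)).threshold.mem
    rw [epsBar_of_add_three_eq (n := n) (by omega)]
    exact optValue_le_Vrec_add_of_costToGo hM hγ hθ ht (fun y hy => costToGo_succ_le hM hγ hθ ht hw
      (ih (t + 1) (by omega) _ (grid_add hw)) hy) hx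

end InventorySystem

namespace InventorySystem

variable {Ω : Type*} [MeasurableSpace Ω] {M : InventorySystem Ω} {γ : ℕ → ℝ}

/-! ### The levels under a policy -/

section Level

variable {pol : ℕ → ℝ → ℝ}

theorem level_zero_succ (x : ℝ) (i : ℕ) (ω : Ω) : M.level pol 0 x (i + 1) ω =
    pol i (M.level pol 0 x i ω) - M.D i ω := by
  simp only [level, zero_add]

variable (M) in
/-- The information generated by the demands of the periods before `n`. -/
abbrev past (n : ℕ) : MeasurableSpace Ω :=
  ⨆ i ∈ {i : Fin M.T | (i : ℕ) < n}, MeasurableSpace.comap (M.D i) inferInstance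

theorem past_mono {m n : ℕ} (h : m ≤ n) : M.past m ≤ M.past n :=
  biSup_mono fun _ hi => lt_of_lt_of_le hi h

theorem past_le (hM : M.StandingAssumptions) (n : ℕ) : M.past n ≤ (inferInstance : MeasurableSpace Ω) :=
  iSup₂_le fun i _ => (hM.D_measurable i i.2).comap_le

theorem measurable_level_past (hpol : IsPolicy pol) (x : ℝ) {n : ℕ} (hn : n ≤ M.T) :
    Measurable[M.past n] (M.level pol 0 x n) := by
  induction n with
  | zero => exact @measurable_const _ _ _ (M.past 0) x
  | succ n ih =>
    have h1 : Measurable[M.past (n + 1)] fun ω => pol n (M.level pol 0 x n ω) :=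
      (hpol n).1.comp ((ih (by omega)).mono (past_mono n.le_succ) le_rfl)
    have h2 : Measurable[M.past (n + 1)] (M.D n) := by
      rw [measurable_iff_comap_le]
      exact le_iSup₂_of_le (f := fun (i : Fin M.T) (_ : i ∈ {i : Fin M.T | (i : ℕ) < n + 1}) =>
        MeasurableSpace.comap (M.D i) inferInstance) ⟨n, hn⟩ n.lt_succ_self le_rfl
    have h3 : M.level pol 0 x (n + 1) = fun ω => pol n (M.level pol 0 x n ω) - M.D n ω :=
      funext fun ω => level_zero_succ x n ω
    rw [h3]
    exact h1.sub h2

theorem measurable_level (hM : M.StandingAssumptions) (hpol : IsPolicy pol) (x : ℝ) {n : ℕ}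
    (hn : n ≤ M.T) : Measurable (M.level pol 0 x n) :=
  (measurable_level_past hpol x hn).mono (past_le hM n) le_rfl

theorem indepFun_order_demand (hM : M.StandingAssumptions) (hpol : IsPolicy pol) (x : ℝ) {n : ℕ}
    (hn : n < M.T) : IndepFun (fun ω => pol n (M.level pol 0 x n ω)) (M.D n) M.P := by
  rw [IndepFun_iff_Indep]
  have hST : Disjoint {i : Fin M.T | (i : ℕ) < n} {⟨n, hn⟩} := by
    rw [Set.disjoint_singleton_right]
    exact lt_irrefl n
  have h := indep_iSup_of_disjoint
    (m := fun i : Fin M.T => MeasurableSpace.comap (M.D i) (inferInstance : MeasurableSpace ℝ))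
    (fun i => (hM.D_measurable i i.2).comap_le) hM.D_indep hST
  refine indep_of_indep_of_le h ?_ ?_
  · exact measurable_iff_comap_le.1 ((hpol n).1.comp (measurable_level_past hpol x hn.le))
  · rw [iSup_singleton]

/-- Independence turns the joint law into a product, and Fubini applies because a Lipschitz function
of an integrable variable is integrable. -/
theorem integral_comp_sub_eq {u : ℝ → ℝ} (hu : IsLip u) {P : Measure Ω} [IsProbabilityMeasure P]
    {Y D : Ω → ℝ} (hYm : Measurable Y) (hDm : Measurable D) (hY : Integrable Y P)
    (hD : Integrable D P) (h : IndepFun Y D P) :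
    ∫ ω, u (Y ω - D ω) ∂P = ∫ ω, ∫ ω', u (Y ω - D ω') ∂P ∂P := by
  have hc := hu.continuous
  have hprod := (indepFun_iff_map_prod_eq_prod_map_map hYm.aemeasurable hDm.aemeasurable).1 h
  have hm : Measurable fun p : ℝ × ℝ => u (p.1 - p.2) :=
    hc.measurable.comp (measurable_fst.sub measurable_snd)
  have hint : Integrable (fun p : ℝ × ℝ => u (p.1 - p.2)) ((P.map Y).prod (P.map D)) := by
    rw [← hprod, integrable_map_measure hm.aestronglyMeasurable (hYm.prodMk hDm).aemeasurable]
    exact hu.integrable_comp (hY.sub hD)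
  have : IsProbabilityMeasure (P.map D) := Measure.isProbabilityMeasure_map hDm.aemeasurable
  have : IsProbabilityMeasure (P.map Y) := Measure.isProbabilityMeasure_map hYm.aemeasurable
  have h1 : ∫ ω, u (Y ω - D ω) ∂P = ∫ p, u (p.1 - p.2) ∂(P.map fun ω => (Y ω, D ω)) :=
    (integral_map (hYm.prodMk hDm).aemeasurable hm.aestronglyMeasurable).symm
  rw [h1, hprod, integral_prod _ hint, integral_map hYm.aemeasurable
    hm.stronglyMeasurable.integral_prod_right'.aestronglyMeasurable]
  refine integral_congr_ae (Eventually.of_forall fun ω => ?_)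
  exact integral_map hDm.aemeasurable
    (hc.measurable.comp (measurable_const.sub measurable_id)).aestronglyMeasurable

/-! ### The total cost in terms of the convex one-period costs -/

variable (M pol) in
/-- The setup cost of period `i` plus `C_i` of the level after ordering. -/
noncomputable def stageCost (x : ℝ) (i : ℕ) (ω : Ω) : ℝ :=
  M.K i * (if 0 < pol i (M.level pol 0 x i ω) - M.level pol 0 x i ω then 1 else 0)
    + M.C i (pol i (M.level pol 0 x i ω))

variable (M) in
/-- The centred part of the total cost. -/
noncomputable def demandNoise (ω : Ω) : ℝ :=
  ∑ i ∈ Finset.range M.T, M.α ^ (i + 1) * M.c (i + 1) * (M.D i ω - ∫ ω', M.D i ω' ∂M.P)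

/-- Telescoping: the term -c_m x_m left after m periods absorbs the ordering cost of period m, and C
was defined so that only the centred demand remains. -/
theorem totalCost_eq (x : ℝ) (ω : Ω) : M.totalCost pol 0 x ω =
    -(M.c 0 * x) + ∑ i ∈ Finset.range M.T, M.α ^ i * M.stageCost pol x i ω + M.demandNoise ω := by
  have key : ∀ m, (∑ i ∈ Finset.range m, M.α ^ i *
      M.periodCost i (M.level pol 0 x i ω) (pol i (M.level pol 0 x i ω)))
      + M.α ^ m * (-(M.c m) * M.level pol 0 x m ω) =
    -(M.c 0 * x) + ∑ i ∈ Finset.range m, M.α ^ i * M.stageCost pol x i ω +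
      ∑ i ∈ Finset.range m,
        M.α ^ (i + 1) * M.c (i + 1) * (M.D i ω - ∫ ω', M.D i ω' ∂M.P) := by
    intro m
    induction m with
    | zero => simp [level]
    | succ m ih =>
      rw [Finset.sum_range_succ, Finset.sum_range_succ, Finset.sum_range_succ, level_zero_succ]
      have h1 : M.α ^ m * M.periodCost m (M.level pol 0 x m ω) (pol m (M.level pol 0 x m ω))
          + M.α ^ (m + 1) * (-(M.c (m + 1)) * (pol m (M.level pol 0 x m ω) - M.D m ω))
          = M.α ^ m * (-(M.c m) * M.level pol 0 x m ω) + M.α ^ m * M.stageCost pol x m ω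
            + M.α ^ (m + 1) * M.c (m + 1) * (M.D m ω - ∫ ω', M.D m ω' ∂M.P) := by
        unfold periodCost stageCost C
        ring
      linarith
  have := key M.T
  simpa only [totalCost, demandNoise, zero_add, Nat.sub_zero] using this

theorem integrable_demandNoise (hM : M.StandingAssumptions) : Integrable M.demandNoise M.P := by
  have := hM.isProb
  exact integrable_finsetSum _ fun i hi =>
    ((hM.D_integrable i (Finset.mem_range.1 hi)).sub (integrable_const _)).const_mul _

theorem integral_demandNoise (hM : M.StandingAssumptions) : ∫ ω, M.demandNoise ω ∂M.P = 0 := by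
  have := hM.isProb
  unfold demandNoise
  have hi : ∀ i ∈ Finset.range M.T, Integrable (fun ω => M.α ^ (i + 1) * M.c (i + 1) *
      (M.D i ω - ∫ ω', M.D i ω' ∂M.P)) M.P := fun i hi =>
    ((hM.D_integrable i (Finset.mem_range.1 hi)).sub (integrable_const _)).const_mul _
  rw [integral_finsetSum _ hi]
  refine Finset.sum_eq_zero fun i hi => ?_
  rw [integral_const_mul, integral_sub (hM.D_integrable i (Finset.mem_range.1 hi))
    (integrable_const _)]
  simp

theorem integrable_totalCost_iff (hM : M.StandingAssumptions) (x : ℝ) :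
    Integrable (M.totalCost pol 0 x) M.P ↔
      Integrable (fun ω => ∑ i ∈ Finset.range M.T, M.α ^ i * M.stageCost pol x i ω) M.P := by
  have := hM.isProb
  have hn := integrable_demandNoise hM
  rw [show M.totalCost pol 0 x = _ from funext fun ω => totalCost_eq x ω]
  refine ⟨fun h => ?_, fun h => ((integrable_const _).add h).add hn⟩
  refine ((h.sub hn).sub (integrable_const (-(M.c 0 * x)))).congr
    (Eventually.of_forall fun ω => ?_)
  simp only [Pi.sub_apply]
  ring

theorem integral_totalCost (hM : M.StandingAssumptions) (x : ℝ)
    (h : Integrable (fun ω => ∑ i ∈ Finset.range M.T, M.α ^ i * M.stageCost pol x i ω) M.P) :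
    ∫ ω, M.totalCost pol 0 x ω ∂M.P =
      ∫ ω, ∑ i ∈ Finset.range M.T, M.α ^ i * M.stageCost pol x i ω ∂M.P - M.c 0 * x := by
  have := hM.isProb
  have hn := integrable_demandNoise hM
  have h' : Integrable (fun ω => -(M.c 0 * x) +
    ∑ i ∈ Finset.range M.T, M.α ^ i * M.stageCost pol x i ω) M.P := (integrable_const _).add h
  simp only [totalCost_eq]
  rw [integral_add h' hn, integral_add (integrable_const _) h, integral_demandNoise hM,
    integral_const, probReal_univ, one_smul]
  ring

/-! ### Dynamic programming -/

theorem measurable_order (hM : M.StandingAssumptions) (hpol : IsPolicy pol) (x : ℝ) {i : ℕ}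
    (hi : i < M.T) : Measurable fun ω => pol i (M.level pol 0 x i ω) :=
  (hpol i).1.comp (measurable_level hM hpol x hi.le)

theorem integrable_setup (hM : M.StandingAssumptions) (hpol : IsPolicy pol) (x : ℝ) {i : ℕ}
    (hi : i < M.T) : Integrable (fun ω => M.K i *
      (if 0 < pol i (M.level pol 0 x i ω) - M.level pol 0 x i ω then (1 : ℝ) else 0)) M.P := by
  have := hM.isProb
  refine Integrable.const_mul (Integrable.of_bound (C := 1) ?_ (Eventually.of_forall fun ω => ?_)) _
  · exact (Measurable.ite (measurableSet_lt measurable_const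
      ((measurable_order hM hpol x hi).sub (measurable_level hM hpol x hi.le)))
      measurable_const measurable_const).aestronglyMeasurable
  · split_ifs <;> simp

theorem integrable_stageCost (hM : M.StandingAssumptions) (hγ : M.LipschitzCondition γ)
    (hpol : IsPolicy pol) (x : ℝ) {i : ℕ} (hi : i < M.T)
    (hY : Integrable (fun ω => pol i (M.level pol 0 x i ω)) M.P) :
    Integrable (M.stageCost pol x i) M.P := by
  have := hM.isProb
  exact (integrable_setup hM hpol x hi).add ((hγ.isLip hi).integrable_comp hY)

theorem integrable_level (hM : M.StandingAssumptions) (x : ℝ) {i : ℕ} (hi : i ≤ M.T)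
    (hY : ∀ j < i, Integrable (fun ω => pol j (M.level pol 0 x j ω)) M.P) :
    Integrable (M.level pol 0 x i) M.P := by
  have := hM.isProb
  cases i with
  | zero => exact integrable_const x
  | succ i =>
    refine ((hY i i.lt_succ_self).sub (hM.D_integrable i hi)).congr
      (Eventually.of_forall fun ω => ?_)
    exact (level_zero_succ x i ω).symm

/-- One step of the dynamic program, in expectation. -/
theorem integral_setup_add_costToGo (hM : M.StandingAssumptions) (hγ : M.LipschitzCondition γ)
    (hpol : IsPolicy pol) (x : ℝ) {i n : ℕ} (h : i + n + 1 = M.T)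
    (hY : Integrable (fun ω => pol i (M.level pol 0 x i ω)) M.P) :
    ∫ ω, (M.K i * (if 0 < pol i (M.level pol 0 x i ω) - M.level pol 0 x i ω then 1 else 0)
        + M.costToGo n i (pol i (M.level pol 0 x i ω))) ∂M.P =
      ∫ ω, M.stageCost pol x i ω ∂M.P
        + M.α * ∫ ω, M.optValue n (i + 1) (M.level pol 0 x (i + 1) ω) ∂M.P := by
  have := hM.isProb
  have hi : i < M.T := by omega
  have hu := isLip_optValue hM hγ (show i + 1 + n = M.T by omega)
  have h1 := integral_comp_sub_eq hu (measurable_order hM hpol x hi) (hM.D_measurable i hi) hY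
    (hM.D_integrable i hi) (indepFun_order_demand hM hpol x hi)
  have h2 : Integrable (fun ω => ∫ ω', M.optValue n (i + 1)
      (pol i (M.level pol 0 x i ω) - M.D i ω') ∂M.P) M.P :=
    (isLip_integral_sub_demand hu hM hi).integrable_comp hY
  simp only [level_zero_succ]
  rw [h1, ← integral_const_mul, ← integral_add (integrable_stageCost hM hγ hpol x hi hY)
    (h2.const_mul _)]
  refine integral_congr_ae (Eventually.of_forall fun ω => ?_)
  simp only [stageCost, costToGo]
  ring

theorem integral_sum_stageCost (hM : M.StandingAssumptions) (hγ : M.LipschitzCondition γ)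
    (hpol : IsPolicy pol) (x : ℝ)
    (hY : ∀ i < M.T, Integrable (fun ω => pol i (M.level pol 0 x i ω)) M.P) :
    ∫ ω, ∑ i ∈ Finset.range M.T, M.α ^ i * M.stageCost pol x i ω ∂M.P =
      ∑ i ∈ Finset.range M.T, M.α ^ i * ∫ ω, M.stageCost pol x i ω ∂M.P := by
  rw [integral_finsetSum _ fun i hi => (integrable_stageCost hM hγ hpol x (Finset.mem_range.1 hi)
    (hY i (Finset.mem_range.1 hi))).const_mul _]
  simp only [integral_const_mul]

theorem optValue_le_integral_stageCost (hM : M.StandingAssumptions) (hγ : M.LipschitzCondition γ)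
    (hpol : IsPolicy pol) (x : ℝ)
    (hY : ∀ i < M.T, Integrable (fun ω => pol i (M.level pol 0 x i ω)) M.P) :
    M.optValue M.T 0 x ≤ ∫ ω, ∑ i ∈ Finset.range M.T, M.α ^ i * M.stageCost pol x i ω ∂M.P := by
  have := hM.isProb
  rw [integral_sum_stageCost hM hγ hpol x hY]
  have key : ∀ m n, m + n = M.T → M.optValue M.T 0 x ≤
      ∑ i ∈ Finset.range m, M.α ^ i * ∫ ω, M.stageCost pol x i ω ∂M.P
        + M.α ^ m * ∫ ω, M.optValue n m (M.level pol 0 x m ω) ∂M.P := by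
    intro m
    induction m with
    | zero =>
      intro n hn
      obtain rfl : n = M.T := by omega
      simp [level]
    | succ m ih =>
      intro n hn
      have h1 := ih (n + 1) (by omega)
      have hm : m < M.T := by omega
      have hJ := isCostToGo_costToGo hM hγ (n := n) (t := m) (by omega)
      have h2 : ∫ ω, M.optValue (n + 1) m (M.level pol 0 x m ω) ∂M.P ≤
          ∫ ω, (M.K m * (if 0 < pol m (M.level pol 0 x m ω) - M.level pol 0 x m ω then 1 else 0)
            + M.costToGo n m (pol m (M.level pol 0 x m ω))) ∂M.P :=
        integral_mono ((isLip_optValue hM hγ (by omega)).integrable_comp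
          (integrable_level hM x hm.le fun j hj => hY j (by omega)))
          ((integrable_setup hM hpol x hm).add (hJ.lip.integrable_comp (hY m hm)))
          fun ω => hJ.orderValue_le ((hpol m).2 _)
      rw [integral_setup_add_costToGo hM hγ hpol x (by omega) (hY m hm)] at h2
      have h3 := mul_le_mul_of_nonneg_left h2 (pow_nonneg hM.α_pos.le m)
      rw [Finset.sum_range_succ, pow_succ]
      linarith
  have h := key M.T 0 (by omega)
  simpa [optValue] using h

/-- Every stage cost is at least ε |y| - B. A sum of terms bounded below dominates each of them, so
integrable total cost forces every order level to be integrable. -/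
theorem integrable_order_of_integrable_sum (hM : M.StandingAssumptions)
    (hγ : M.LipschitzCondition γ) (hpol : IsPolicy pol) (x : ℝ)
    (h : Integrable (fun ω => ∑ i ∈ Finset.range M.T, M.α ^ i * M.stageCost pol x i ω) M.P) :
    ∀ i < M.T, Integrable (fun ω => pol i (M.level pol 0 x i ω)) M.P := by
  have := hM.isProb
  have hg : ∀ i, ∃ ε > 0, ∃ B, i < M.T → ∀ ω,
      ε * |pol i (M.level pol 0 x i ω)| - B ≤ M.stageCost pol x i ω := by
    intro i
    by_cases hi : i < M.T
    · obtain ⟨ε, hε, B, hB⟩ := exists_linear_growth (hγ.isLip hi).continuous (hM.C_convex i hi)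
        (hM.C_coercive i hi)
      refine ⟨ε, hε, B, fun _ ω => ?_⟩
      have h1 : 0 ≤ M.K i *
          (if 0 < pol i (M.level pol 0 x i ω) - M.level pol 0 x i ω then (1 : ℝ) else 0) :=
        mul_nonneg (hM.K_nonneg i hi) (by split_ifs <;> norm_num)
      unfold stageCost
      linarith [hB (pol i (M.level pol 0 x i ω))]
    · exact ⟨1, one_pos, 0, fun h => absurd h hi⟩
  choose ε hε B hB using hg
  intro i hi
  have hα : ∀ j, 0 < M.α ^ j := fun j => pow_pos hM.α_pos j
  refine Integrable.mono' (g := fun ω => (∑ j ∈ Finset.range M.T, M.α ^ j * M.stageCost pol x j ω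
      + ∑ j ∈ Finset.range M.T, M.α ^ j * B j) * (M.α ^ i * ε i)⁻¹)
    ((h.add (integrable_const _)).mul_const _) (measurable_order hM hpol x hi).aestronglyMeasurable
    (Eventually.of_forall fun ω => ?_)
  rw [← div_eq_mul_inv, le_div_iff₀ (mul_pos (hα i) (hε i)), ← Finset.sum_add_distrib,
    Real.norm_eq_abs]
  have h1 : ∀ j ∈ Finset.range M.T,
      0 ≤ M.α ^ j * M.stageCost pol x j ω + M.α ^ j * B j := by
    intro j hj
    rw [← mul_add]
    have h2 := hB j (Finset.mem_range.1 hj) ω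
    have h3 := mul_nonneg (hε j).le (abs_nonneg (pol j (M.level pol 0 x j ω)))
    exact mul_nonneg (hα j).le (by linarith)
  have h2 := Finset.single_le_sum h1 (Finset.mem_range.2 hi)
  have h3 := mul_le_mul_of_nonneg_left (hB i hi ω) (hα i).le
  linarith

end Level

theorem exists_optimal_policy (hM : M.StandingAssumptions) (hγ : M.LipschitzCondition γ) (x : ℝ) :
    ∃ pol, IsPolicy pol ∧ (∀ i < M.T, Integrable (fun ω => pol i (M.level pol 0 x i ω)) M.P) ∧
      ∫ ω, ∑ i ∈ Finset.range M.T, M.α ^ i * M.stageCost pol x i ω ∂M.P = M.optValue M.T 0 x := by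
  have := hM.isProb
  have hsel : ∀ i, ∃ p : ℝ → ℝ, (Measurable p ∧ ∀ y, y ≤ p y) ∧ ∀ n, i + n + 1 = M.T → ∀ y,
      M.optValue (n + 1) i y =
        M.K i * (if 0 < p y - y then 1 else 0) + M.costToGo n i (p y) := by
    intro i
    by_cases hi : i < M.T
    · obtain ⟨n, hn⟩ : ∃ n, i + n + 1 = M.T := ⟨M.T - 1 - i, by omega⟩
      obtain ⟨p, h1, h2, h3⟩ := (isCostToGo_costToGo hM hγ hn).exists_measurable_selector
        (hM.K_nonneg i hi)
      refine ⟨p, ⟨h1, h2⟩, fun m hm y => ?_⟩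
      obtain rfl : m = n := by omega
      exact h3 y
    · exact ⟨id, ⟨measurable_id, fun y => le_rfl⟩, fun n hn => by omega⟩
  choose pol hpol hopt using hsel
  have hpol : IsPolicy pol := hpol
  -- The optimal value at an integrable level is integrable, being Lipschitz, and it dominates ε
  -- times the absolute order level up to a constant; so integrability propagates forward in time.
  have hY : ∀ i < M.T, Integrable (fun ω => pol i (M.level pol 0 x i ω)) M.P := by
    intro i
    induction i using Nat.strong_induction_on with
    | _ i ih =>
      intro hi
      obtain ⟨n, hn⟩ : ∃ n, i + n + 1 = M.T := ⟨M.T - 1 - i, by omega⟩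
      have hX := integrable_level hM x hi.le fun j hj => ih j hj (by omega)
      have hU := (isLip_optValue hM hγ (show i + (n + 1) = M.T by omega)).integrable_comp hX
      obtain ⟨ε, hε, B, hB⟩ := (isCostToGo_costToGo hM hγ hn).growth
      refine Integrable.mono' (g := fun ω => (M.optValue (n + 1) i (M.level pol 0 x i ω) + B) * ε⁻¹)
        ((hU.add (integrable_const _)).mul_const _)
        (measurable_order hM hpol x hi).aestronglyMeasurable (Eventually.of_forall fun ω => ?_)
      rw [← div_eq_mul_inv, le_div_iff₀ hε, Real.norm_eq_abs, hopt i n hn]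
      have h1 : 0 ≤ M.K i *
          (if 0 < pol i (M.level pol 0 x i ω) - M.level pol 0 x i ω then (1 : ℝ) else 0) :=
        mul_nonneg (hM.K_nonneg i hi) (by split_ifs <;> norm_num)
      linarith [hB (pol i (M.level pol 0 x i ω))]
  refine ⟨pol, hpol, hY, ?_⟩
  rw [integral_sum_stageCost hM hγ hpol x hY]
  have key : ∀ m n, m + n = M.T → ∑ i ∈ Finset.range m, M.α ^ i * ∫ ω, M.stageCost pol x i ω ∂M.P
        + M.α ^ m * ∫ ω, M.optValue n m (M.level pol 0 x m ω) ∂M.P = M.optValue M.T 0 x := by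
    intro m
    induction m with
    | zero =>
      intro n hn
      obtain rfl : n = M.T := by omega
      simp [level]
    | succ m ih =>
      intro n hn
      have h1 := ih (n + 1) (by omega)
      have h2 := integral_setup_add_costToGo hM hγ hpol x (show m + n + 1 = M.T by omega)
        (hY m (by omega))
      simp only [← hopt m n (by omega)] at h2
      rw [h2] at h1
      rw [Finset.sum_range_succ, pow_succ, ← h1]
      ring
  have h := key M.T 0 (by omega)
  simpa [optValue] using h

theorem isLeast_attainableCosts (hM : M.StandingAssumptions) (hγ : M.LipschitzCondition γ)
    (x : ℝ) : IsLeast (M.attainableCosts 0 x) (M.optValue M.T 0 x - M.c 0 * x) := by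
  constructor
  · obtain ⟨pol, hpol, hY, h⟩ := exists_optimal_policy hM hγ x
    have hint : Integrable (fun ω => ∑ i ∈ Finset.range M.T, M.α ^ i * M.stageCost pol x i ω) M.P :=
      integrable_finsetSum _ fun i hi => (integrable_stageCost hM hγ hpol x
        (Finset.mem_range.1 hi) (hY i (Finset.mem_range.1 hi))).const_mul _
    refine ⟨pol, hpol, (integrable_totalCost_iff hM x).2 hint, ?_⟩
    rw [integral_totalCost hM x hint, h]
  · rintro _ ⟨pol, hpol, hint, rfl⟩
    rw [integrable_totalCost_iff hM] at hint
    rw [integral_totalCost hM x hint]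
    exact sub_le_sub_right (optValue_le_integral_stageCost hM hγ hpol x
      (integrable_order_of_integrable_sum hM hγ hpol x hint)) _

end InventorySystem

/-! ### Assembly of the two bounds at period 0. -/

theorem theorem4p7 {Ω : Type*} [MeasurableSpace Ω] (M : InventorySystem Ω)
    (hM : M.StandingAssumptions) (hT : 2 ≤ M.T)
    (γ : ℕ → ℝ) (hγ : M.LipschitzCondition γ) (θ : ℝ) (hθ : 0 < θ)
    (k : ℤ) (x : ℝ) (hx₁ : ((k : ℝ) - 1) * θ < x) (hx₂ : x ≤ (k : ℝ) * θ) :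
    IsLeast (M.attainableCosts 0 x) (M.optimalCost 0 x) ∧
    -M.omegaBar θ γ 0 (k * θ) ≤ M.optimalCost 0 x - (M.V θ 0 x - M.c 0 * x) ∧
    M.optimalCost 0 x - (M.V θ 0 x - M.c 0 * x) ≤ M.epsBar θ γ 0 (k * θ) := by
  have hleast := InventorySystem.isLeast_attainableCosts hM hγ x
  have hopt : M.optimalCost 0 x = M.optValue M.T 0 x - M.c 0 * x := hleast.csInf_eq
  obtain ⟨n, hn⟩ : ∃ n, n + 2 = M.T := ⟨M.T - 2, by omega⟩
  have hz : (k : ℝ) * θ ∈ InventorySystem.grid θ := ⟨k, rfl⟩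
  have hV : M.V θ 0 x = M.Vrec θ (n + 1) 0 x := by
    rw [InventorySystem.V, show M.T - 1 - 0 = n + 1 by omega]
    rfl
  have hω : M.omegaBar θ γ 0 (k * θ) = M.omegaBarRec θ γ (n + 1) 0 (k * θ) := by
    rw [InventorySystem.omegaBar, show M.T - 1 - 0 = n + 1 by omega]
    rfl
  have hlow := InventorySystem.Vrec_le_optValue_add hM hγ hθ (n + 1) 0 (by omega) _ hz x
    (by linarith) hx₂
  have hup := InventorySystem.optValue_le_Vrec_add hM hγ hθ n 0 (by omega) _ hz x hx₂
  rw [hopt, hV, hω, ← hn]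
  refine ⟨?_, by linarith, by linarith⟩
  rwa [← hn] at hleast
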